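/- Let $M$ be a closed connected oriented (topological) manifold and let $\psi : M\times M\to M$ be a $\Gamma$-structure on $M$, that is, a continuous map such that the restrictions $\psi_p : M\to M,\ y\mapsto\psi(p,y)$ and $\psi^q : M\to M,\ x\mapsto\psi(x,q)$ have non-zero mapping degrees for some points $p,q\in M$. Then the fundamental group of $M$ (at any base point) is virtually abelian, i.e. it has an abelian subgroup of finite index. More precisely, for all $p,q\in M$, let $$H_1 := (\psi_p)_*\,\pi_1(M,q)\subset\pi_1(M,\psi(p,q)),\qquad H_2 := (\psi^q)_*\,\pi_1(M,p)\subset\pi_1(M,\psi(p,q)).$$ Then $H_1$ and $H_2$ have finite index in $\pi_1(M,\psi(p,q))$, every element of $H_1$ commutes with every element of $H_2$, and $H_1\cap H_2$ is an abelian subgroup of finite index in $\pi_1(M,\psi(p,q))$. -/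

import Mathlib

open CategoryTheory Topology

universe u

noncomputable section

namespace GammaManifold

/-! ### Integral singular homology, absolute and relative -/

/-- The integral singular chain complex of a topological space. -/
abbrev singularChains (X : Type u) [TopologicalSpace X] : ChainComplex (ModuleCat.{u} ℤ) ℕ :=
  ((AlgebraicTopology.singularChainComplexFunctor (ModuleCat.{u} ℤ)).obj
    (ModuleCat.of ℤ (ULift.{u} ℤ))).obj (TopCat.of X)

/-- The chain map induced by a continuous map. -/
abbrev singularChainsMap {X Y : Type u} [TopologicalSpace X] [TopologicalSpace Y]
    (f : C(X, Y)) : singularChains X ⟶ singularChains Y :=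
  ((AlgebraicTopology.singularChainComplexFunctor (ModuleCat.{u} ℤ)).obj
    (ModuleCat.of ℤ (ULift.{u} ℤ))).map (TopCat.ofHom f)

/-- Integral singular homology `H_n(X; ℤ)`. -/
abbrev singularHomology (n : ℕ) (X : Type u) [TopologicalSpace X] : ModuleCat.{u} ℤ :=
  (singularChains X).homology n

/-- The map `f_* : H_n(X; ℤ) → H_n(Y; ℤ)` induced by a continuous map `f`. -/
abbrev singularHomologyMap (n : ℕ) {X Y : Type u} [TopologicalSpace X] [TopologicalSpace Y]
    (f : C(X, Y)) : singularHomology n X ⟶ singularHomology n Y :=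
  HomologicalComplex.homologyMap (singularChainsMap f) n

/-- The inclusion of a subspace as a continuous map. -/
def subspaceInclusion {X : Type u} [TopologicalSpace X] (A : Set X) : C(A, X) :=
  ⟨Subtype.val, continuous_subtype_val⟩

/-- The inclusion of one subspace into a larger one as a continuous map. -/
def subspaceMap {X : Type u} [TopologicalSpace X] {A B : Set X} (h : A ⊆ B) : C(A, B) :=
  ⟨Set.inclusion h, continuous_inclusion h⟩

theorem subspaceMap_comm {X : Type u} [TopologicalSpace X] {A B : Set X} (h : A ⊆ B) :
    singularChainsMap (subspaceInclusion A) ≫ 𝟙 (singularChains X) =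
      singularChainsMap (subspaceMap h) ≫ singularChainsMap (subspaceInclusion B) := by
  rw [Category.comp_id, ← Functor.map_comp]
  rfl

/-- The relative singular chain complex `C_*(X, A) = C_*(X) / C_*(A)`. -/
abbrev relativeChains (X : Type u) [TopologicalSpace X] (A : Set X) :
    ChainComplex (ModuleCat.{u} ℤ) ℕ :=
  Limits.cokernel (singularChainsMap (subspaceInclusion A))

/-- Relative integral singular homology `H_n(X, A; ℤ)`. -/
abbrev relativeHomology (n : ℕ) (X : Type u) [TopologicalSpace X] (A : Set X) :
    ModuleCat.{u} ℤ :=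
  (relativeChains X A).homology n

/-- The canonical map `H_n(X; ℤ) → H_n(X, A; ℤ)`. -/
abbrev toRelativeHomology (n : ℕ) (X : Type u) [TopologicalSpace X] (A : Set X) :
    singularHomology n X ⟶ relativeHomology n X A :=
  HomologicalComplex.homologyMap
    (Limits.cokernel.π (singularChainsMap (subspaceInclusion A))) n

/-- The canonical map `H_n(X, A; ℤ) → H_n(X, B; ℤ)` for `A ⊆ B`. -/
abbrev relativeHomologyMap (n : ℕ) {X : Type u} [TopologicalSpace X] {A B : Set X}
    (h : A ⊆ B) : relativeHomology n X A ⟶ relativeHomology n X B :=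
  HomologicalComplex.homologyMap
    (Limits.cokernel.map (singularChainsMap (subspaceInclusion A))
      (singularChainsMap (subspaceInclusion B)) (singularChainsMap (subspaceMap h))
      (𝟙 (singularChains X)) (subspaceMap_comm h)) n

/-! ### Orientations, fundamental classes, mapping degrees -/

/-- `g` generates the infinite cyclic group `G`: each element of `G` is `k • g` for exactly one
integer `k`. -/
def IsInfiniteCyclicGenerator {G : Type*} [AddCommGroup G] (g : G) : Prop :=
  Function.Bijective (fun k : ℤ => k • g)

/-- An orientation of an `n`-manifold `M`: a choice of a generator `μ_x` of the infinite cyclic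
group `H_n(M, M ∖ {x}; ℤ)` for each point `x`, which is locally consistent, that is, each point has
a neighbourhood `U` such that all `μ_y` with `y ∈ U` are images of a single class in
`H_n(M, M ∖ U; ℤ)`. -/
structure Orientation (n : ℕ) (M : Type u) [TopologicalSpace M] where
  /-- The local orientation at a point. -/
  localClass : ∀ x : M, relativeHomology n M ({x}ᶜ : Set M)
  generator : ∀ x : M, IsInfiniteCyclicGenerator (localClass x)
  consistent : ∀ x : M, ∃ U ∈ 𝓝 x, ∃ α : relativeHomology n M (Uᶜ : Set M),
    ∀ (y : M) (hy : y ∈ U),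
      relativeHomologyMap n (Set.compl_subset_compl.mpr (Set.singleton_subset_iff.mpr hy)) α =
        localClass y

/-- `c ∈ H_n(M; ℤ)` is the fundamental class of the oriented manifold `M`: it restricts to the
given local orientation at each point. -/
def IsFundamentalClass {n : ℕ} {M : Type u} [TopologicalSpace M] (o : Orientation n M)
    (c : singularHomology n M) : Prop :=
  ∀ x : M, toRelativeHomology n M ({x}ᶜ : Set M) c = o.localClass x

/-- The self-map `f` of the oriented manifold `M` has mapping degree `d`: `f_* [M] = d [M]` for the
fundamental class `[M]`. -/
def HasMappingDegree {n : ℕ} {M : Type u} [TopologicalSpace M] (o : Orientation n M)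
    (f : C(M, M)) (d : ℤ) : Prop :=
  ∃ c : singularHomology n M, IsFundamentalClass o c ∧ singularHomologyMap n f c = d • c

/-! ### `Γ`-structures -/

/-- The restriction `ψ_p : y ↦ ψ (p, y)`. -/
def restrictLeft {M : Type u} [TopologicalSpace M] (ψ : C(M × M, M)) (p : M) : C(M, M) :=
  ⟨fun y => ψ (p, y), by fun_prop⟩

/-- The restriction `ψ^q : x ↦ ψ (x, q)`. -/
def restrictRight {M : Type u} [TopologicalSpace M] (ψ : C(M × M, M)) (q : M) : C(M, M) :=
  ⟨fun x => ψ (x, q), by fun_prop⟩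

/-- A `Γ`-structure on an oriented manifold: a continuous map `ψ : M × M → M` such that
`ψ_p` and `ψ^q` have non-zero mapping degrees for some points `p`, `q`. -/
def IsGammaStructure {n : ℕ} {M : Type u} [TopologicalSpace M] (o : Orientation n M)
    (ψ : C(M × M, M)) : Prop :=
  ∃ p q : M, (∃ d : ℤ, d ≠ 0 ∧ HasMappingDegree o (restrictLeft ψ p) d) ∧
    (∃ d : ℤ, d ≠ 0 ∧ HasMappingDegree o (restrictRight ψ q) d)

/-! ### Fundamental groups -/

/-- A group is virtually abelian if it has an abelian subgroup of finite index. -/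
def IsVirtuallyAbelian (G : Type*) [Group G] : Prop :=
  ∃ N : Subgroup G, IsMulCommutative N ∧ N.FiniteIndex

/-- The image of `(ψ_p)_* : π_1(M, q) → π_1(M, ψ (p, q))`. -/
def leftImage {M : Type u} [TopologicalSpace M] (ψ : C(M × M, M)) (p q : M) :
    Subgroup (FundamentalGroup M (ψ (p, q))) :=
  (FundamentalGroup.mapOfEq (restrictLeft ψ p) (x := q) (y := ψ (p, q)) rfl).range

/-- The image of `(ψ^q)_* : π_1(M, p) → π_1(M, ψ (p, q))`. -/
def rightImage {M : Type u} [TopologicalSpace M] (ψ : C(M × M, M)) (p q : M) :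
    Subgroup (FundamentalGroup M (ψ (p, q))) :=
  (FundamentalGroup.mapOfEq (restrictRight ψ q) (x := p) (y := ψ (p, q)) rfl).range

end GammaManifold

end

/-! Commutation is formal: in `π₁(M × M, (p, q))` loops in `{p} × M` commute with loops in `M ×
{q}`, and `ψ` carries this to `H₁` and `H₂`. Hence `H₁ ∩ H₂` is abelian, and everything else follows
once `H₁` and `H₂` have finite index. As `M` is path connected, all `ψ_p` are homotopic, and so are
all `ψ^q`; so all have non-zero degree, and it suffices that a self-map `f` of non-zero degree has
image of finite index on `π₁` (`HasMappingDegree.finiteIndex_range`).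

Suppose the index is infinite. Then `f` lifts to the connected cover `p : E → M` belonging to the
image, whose fibre over the base point `x` is infinite. Let `c` be the lifted fundamental cycle.
Subdivide it until every simplex meets `p⁻¹(x)` in at most one point. The simplices through a point
`y` of the fibre then project to a relative cycle at `p y`, a multiple of the local orientation;
call the multiple the local degree of `c` at `y`. It does not depend on the subdivision and is
locally constant in `y`, so it is constant on `E`. A chain involves finitely many simplices, so some
point of the infinite fibre is missed and has local degree zero. All local degrees then vanish, and
`p_* c`, locally their sum, is zero in `H_n(M, M ∖ {x})`
(`push_mem_relBoundaries_of_infinite_fibre`). But it represents `deg f` times a generator, so `deg f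
= 0`.

About `E` only three facts are needed: it is Hausdorff, it is connected, and `p` is locally
injective. The chain-level argument is made in free abelian groups on singular simplices, with
explicit barycentric subdivision, and is then carried over to the singular chain complex. -/

noncomputable section

namespace VertexChain

/-! ### Chains of ordered simplices on a set of vertices -/

variable {K L : Type*}

/-- The free abelian group on the ordered `n`-simplices with vertices in `K`. -/
abbrev Chains (n : ℕ) (K : Type*) := (Fin (n + 1) → K) →₀ ℤ

/-- The alternating sum of the faces. -/
def boundary (n : ℕ) : Chains (n + 1) K →ₗ[ℤ] Chains n K :=
  Finsupp.linearCombination ℤ fun v =>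
    ∑ i : Fin (n + 2), ((-1 : ℤ) ^ (i : ℕ)) • Finsupp.single (v ∘ i.succAbove) 1

/-- The cone with apex `b`. -/
def cone (n : ℕ) (b : K) : Chains n K →ₗ[ℤ] Chains (n + 1) K :=
  Finsupp.lmapDomain ℤ ℤ fun v => (Fin.cons b v : Fin (n + 2) → K)

/-- The map induced by a map of vertices. -/
def map (n : ℕ) (g : K → L) : Chains n K →ₗ[ℤ] Chains n L :=
  Finsupp.lmapDomain ℤ ℤ fun v => g ∘ v

/-- The augmentation. -/
def augmentation (K : Type*) : Chains 0 K →ₗ[ℤ] ℤ :=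
  Finsupp.linearCombination ℤ fun _ => (1 : ℤ)

@[simp] lemma boundary_single (n : ℕ) (v : Fin (n + 2) → K) :
    boundary n (Finsupp.single v 1) =
      ∑ i : Fin (n + 2), ((-1 : ℤ) ^ (i : ℕ)) • Finsupp.single (v ∘ i.succAbove) 1 := by
  simp [boundary]

@[simp] lemma cone_single (n : ℕ) (b : K) (v : Fin (n + 1) → K) :
    cone n b (Finsupp.single v 1) = Finsupp.single (Fin.cons b v : Fin (n + 2) → K) 1 := by
  simp [cone]

@[simp] lemma map_single (n : ℕ) (g : K → L) (v : Fin (n + 1) → K) :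
    map n g (Finsupp.single v 1) = Finsupp.single (g ∘ v) 1 := by
  simp [map]

@[simp] lemma augmentation_single (v : Fin 1 → K) :
    augmentation K (Finsupp.single v 1) = 1 := by
  simp [augmentation]

lemma hom_ext {n : ℕ} {G : Type*} [AddCommGroup G] [Module ℤ G] {f g : Chains n K →ₗ[ℤ] G}
    (h : ∀ v, f (Finsupp.single v 1) = g (Finsupp.single v 1)) : f = g :=
  Finsupp.lhom_ext' fun v => LinearMap.ext_ring (h v)

lemma cons_comp_succAbove_succ {n : ℕ} (b : K) (v : Fin (n + 2) → K) (i : Fin (n + 2)) :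
    (Fin.cons b v : Fin (n + 3) → K) ∘ i.succ.succAbove = Fin.cons b (v ∘ i.succAbove) := by
  funext j
  refine Fin.cases ?_ (fun j => ?_) j <;> simp

/-- Deleting the apex returns the simplex; deleting any other vertex gives the cone on a face, with
the sign shifted by one. -/
lemma boundary_cone (n : ℕ) (b : K) (c : Chains (n + 1) K) :
    boundary (n + 1) (cone (n + 1) b c) = c - cone n b (boundary n c) := by
  suffices h : boundary (n + 1) ∘ₗ cone (n + 1) b =
      LinearMap.id - cone n b ∘ₗ boundary n from LinearMap.congr_fun h c
  refine hom_ext fun v => ?_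
  simp only [LinearMap.comp_apply, LinearMap.sub_apply, LinearMap.id_apply, cone_single,
    boundary_single, map_sum, map_smul]
  rw [Fin.sum_univ_succ]
  simp only [cons_comp_succAbove_succ, Fin.val_succ, pow_succ]
  simp [sub_eq_add_neg]

/-- In degree zero the other face is the apex itself, counted once per vertex of `c`; this is where
the augmentation enters. -/
lemma boundary_cone_zero (b : K) (c : Chains 0 K) :
    boundary 0 (cone 0 b c) = c - augmentation K c • Finsupp.single (fun _ => b) 1 := by
  suffices h : boundary 0 ∘ₗ cone 0 b =
      LinearMap.id - (augmentation K).smulRight (Finsupp.single (fun _ => b) (1 : ℤ)) from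
    LinearMap.congr_fun h c
  refine hom_ext fun v => ?_
  have h1 : (Fin.cons b v : Fin 2 → K) ∘ Fin.succAbove 1 = fun _ => b := by
    funext j; fin_cases j; rfl
  simp [Fin.sum_univ_two, h1, sub_eq_add_neg]

lemma augmentation_boundary (c : Chains 1 K) : augmentation K (boundary 0 c) = 0 := by
  suffices h : augmentation K ∘ₗ boundary 0 = 0 from LinearMap.congr_fun h c
  refine hom_ext fun v => ?_
  simp [Fin.sum_univ_two]

/-- Every ordered simplex is the cone over its tail from its first vertex, so the cone formula gives
the claim by induction, without a double sum of signs. -/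
lemma boundary_boundary (n : ℕ) (c : Chains (n + 2) K) :
    boundary n (boundary (n + 1) c) = 0 := by
  induction n with
  | zero =>
    suffices h : boundary 0 ∘ₗ boundary 1 = (0 : Chains 2 K →ₗ[ℤ] _) from LinearMap.congr_fun h c
    refine hom_ext fun v => ?_
    rw [← Fin.cons_self_tail v, ← cone_single, LinearMap.comp_apply, boundary_cone, map_sub,
      boundary_cone_zero, augmentation_boundary]
    simp
  | succ n ih =>
    suffices h : boundary (n + 1) ∘ₗ boundary (n + 2) = (0 : Chains (n + 3) K →ₗ[ℤ] _) from
      LinearMap.congr_fun h c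
    refine hom_ext fun v => ?_
    rw [← Fin.cons_self_tail v, ← cone_single, LinearMap.comp_apply, boundary_cone, map_sub,
      boundary_cone, ih]
    simp

lemma map_boundary (n : ℕ) (g : K → L) (c : Chains (n + 1) K) :
    map n g (boundary n c) = boundary n (map (n + 1) g c) := by
  suffices h : map n g ∘ₗ boundary n = boundary n ∘ₗ map (n + 1) g from LinearMap.congr_fun h c
  refine hom_ext fun v => ?_
  simp only [LinearMap.comp_apply, boundary_single, map_sum, map_smul, map_single]
  rfl

lemma map_cone (n : ℕ) (g : K → L) (b : K) (c : Chains n K) :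
    map (n + 1) g (cone n b c) = cone n (g b) (map n g c) := by
  suffices h : map (n + 1) g ∘ₗ cone n b = cone n (g b) ∘ₗ map n g from LinearMap.congr_fun h c
  refine hom_ext fun v => ?_
  simp only [LinearMap.comp_apply, cone_single, map_single]
  congr 1
  funext j
  refine Fin.cases ?_ (fun j => ?_) j <;> simp

/-! ### Subdivision -/

/-- A choice of a centre for each ordered simplex. -/
abbrev Centre (K : Type*) := ∀ n : ℕ, (Fin (n + 1) → K) → K

/-- Subdivision with respect to a choice of centres. -/
def subdivision (β : Centre K) : ∀ n : ℕ, Chains n K →ₗ[ℤ] Chains n K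
  | 0 => LinearMap.id
  | n + 1 => Finsupp.linearCombination ℤ fun v =>
      cone n (β (n + 1) v) (subdivision β n (boundary n (Finsupp.single v 1)))

/-- The chain homotopy from subdivision to the identity. -/
def subdivisionHomotopy (β : Centre K) : ∀ n : ℕ, Chains n K →ₗ[ℤ] Chains (n + 1) K
  | 0 => 0
  | n + 1 => Finsupp.linearCombination ℤ fun v =>
      cone (n + 1) (β (n + 1) v)
        (Finsupp.single v 1 - subdivisionHomotopy β n (boundary n (Finsupp.single v 1)))

lemma subdivision_succ_single (β : Centre K) (n : ℕ) (v : Fin (n + 2) → K) :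
    subdivision β (n + 1) (Finsupp.single v 1) =
      cone n (β (n + 1) v) (subdivision β n (boundary n (Finsupp.single v 1))) := by
  simp only [subdivision, Finsupp.linearCombination_single, one_smul]

lemma subdivisionHomotopy_succ_single (β : Centre K) (n : ℕ) (v : Fin (n + 2) → K) :
    subdivisionHomotopy β (n + 1) (Finsupp.single v 1) = cone (n + 1) (β (n + 1) v)
      (Finsupp.single v 1 - subdivisionHomotopy β n (boundary n (Finsupp.single v 1))) := by
  simp only [subdivisionHomotopy, Finsupp.linearCombination_single, one_smul]

lemma boundary_subdivision (β : Centre K) (n : ℕ) (c : Chains (n + 1) K) :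
    boundary n (subdivision β (n + 1) c) = subdivision β n (boundary n c) := by
  induction n with
  | zero =>
    suffices h : boundary 0 ∘ₗ subdivision β 1 = subdivision β 0 ∘ₗ boundary 0 from
      LinearMap.congr_fun h c
    refine hom_ext fun v => ?_
    simp only [LinearMap.comp_apply, subdivision_succ_single, boundary_cone_zero]
    simp [subdivision, augmentation_boundary, -boundary_single]
  | succ n ih =>
    suffices h : boundary (n + 1) ∘ₗ subdivision β (n + 2) =
        subdivision β (n + 1) ∘ₗ boundary (n + 1) from LinearMap.congr_fun h c
    refine hom_ext fun v => ?_
    simp only [LinearMap.comp_apply, subdivision_succ_single β (n + 1), boundary_cone, ih,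
      boundary_boundary, map_zero, sub_zero]

lemma boundary_subdivisionHomotopy_zero (β : Centre K) (c : Chains 0 K) :
    boundary 0 (subdivisionHomotopy β 0 c) = c - subdivision β 0 c := by
  simp [subdivision, subdivisionHomotopy]

lemma boundary_subdivisionHomotopy (β : Centre K) (n : ℕ) (c : Chains (n + 1) K) :
    boundary (n + 1) (subdivisionHomotopy β (n + 1) c) =
      c - subdivision β (n + 1) c - subdivisionHomotopy β n (boundary n c) := by
  induction n with
  | zero =>
    suffices h : boundary 1 ∘ₗ subdivisionHomotopy β 1 =
        LinearMap.id - subdivision β 1 - subdivisionHomotopy β 0 ∘ₗ boundary 0 from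
      LinearMap.congr_fun h c
    refine hom_ext fun v => ?_
    simp only [LinearMap.comp_apply, LinearMap.sub_apply, LinearMap.id_apply,
      subdivisionHomotopy_succ_single, subdivision_succ_single, boundary_cone, map_sub,
      boundary_subdivisionHomotopy_zero]
    abel
  | succ n ih =>
    suffices h : boundary (n + 2) ∘ₗ subdivisionHomotopy β (n + 2) =
        LinearMap.id - subdivision β (n + 2) - subdivisionHomotopy β (n + 1) ∘ₗ boundary (n + 1)
      from LinearMap.congr_fun h c
    refine hom_ext fun v => ?_
    simp only [LinearMap.comp_apply, LinearMap.sub_apply, LinearMap.id_apply,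
      subdivisionHomotopy_succ_single β (n + 1), subdivision_succ_single β (n + 1), boundary_cone,
      map_sub, ih, boundary_boundary, map_zero, sub_zero]
    abel

/-- Naturality for vertex maps that respect centres. Affine maps respect barycentres, so it suffices
to subdivide the standard simplex. -/
lemma map_subdivision {β : Centre K} {γ : Centre L} {g : K → L}
    (hg : ∀ n v, g (β n v) = γ n (g ∘ v)) (n : ℕ) (c : Chains n K) :
    map n g (subdivision β n c) = subdivision γ n (map n g c) := by
  induction n with
  | zero => rfl
  | succ n ih =>
    suffices h : map (n + 1) g ∘ₗ subdivision β (n + 1) =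
        subdivision γ (n + 1) ∘ₗ map (n + 1) g from LinearMap.congr_fun h c
    refine hom_ext fun v => ?_
    simp only [LinearMap.comp_apply, subdivision_succ_single, map_cone, ih, map_boundary, hg,
      map_single]

lemma map_subdivisionHomotopy {β : Centre K} {γ : Centre L} {g : K → L}
    (hg : ∀ n v, g (β n v) = γ n (g ∘ v)) (n : ℕ) (c : Chains n K) :
    map (n + 1) g (subdivisionHomotopy β n c) = subdivisionHomotopy γ n (map n g c) := by
  induction n with
  | zero => simp [subdivisionHomotopy]
  | succ n ih =>
    suffices h : map (n + 2) g ∘ₗ subdivisionHomotopy β (n + 1) =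
        subdivisionHomotopy γ (n + 1) ∘ₗ map (n + 1) g from LinearMap.congr_fun h c
    refine hom_ext fun v => ?_
    simp only [LinearMap.comp_apply, subdivisionHomotopy_succ_single, map_cone, ih, map_boundary,
      hg, map_single, map_sub]

/-- A linear map of free modules sends `supported s` into `q` if it sends the generators there. -/
lemma _root_.Finsupp.apply_mem_of_mem_supported {S G : Type*} [AddCommGroup G] [Module ℤ G]
    (f : (S →₀ ℤ) →ₗ[ℤ] G) (q : Submodule ℤ G) {s : Set S}
    (h : ∀ v ∈ s, f (Finsupp.single v 1) ∈ q) {c : S →₀ ℤ} (hc : c ∈ Finsupp.supported ℤ ℤ s) :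
    f c ∈ q := by
  rw [Finsupp.supported_eq_span_single] at hc
  have : Submodule.span ℤ ((fun i => Finsupp.single i (1 : ℤ)) '' s) ≤ q.comap f := by
    rw [Submodule.span_le]
    rintro _ ⟨v, hv, rfl⟩
    exact h v hv
  exact this hc

/-- An induction principle: a relation between a simplex and the pieces of its subdivision need only
survive coning a piece of a face from the centre. -/
lemma subdivision_mem_supported {β : Centre K} (P : ∀ n, (Fin (n + 1) → K) → Set (Fin (n + 1) → K))
    (h0 : ∀ v, v ∈ P 0 v)
    (hs : ∀ n v i, ∀ w ∈ P n (v ∘ Fin.succAbove i), Fin.cons (β (n + 1) v) w ∈ P (n + 1) v)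
    (n : ℕ) (v : Fin (n + 1) → K) :
    subdivision β n (Finsupp.single v 1) ∈ Finsupp.supported ℤ ℤ (P n v) := by
  induction n with
  | zero => exact Finsupp.single_mem_supported ℤ 1 (h0 v)
  | succ n ih =>
    rw [subdivision_succ_single, boundary_single, map_sum, map_sum]
    refine Submodule.sum_mem _ fun i _ => ?_
    rw [map_smul, map_smul]
    refine Submodule.smul_mem _ _ ?_
    refine Finsupp.apply_mem_of_mem_supported (cone n (β (n + 1) v)) _ ?_ (ih _)
    intro w hw
    rw [cone_single]
    exact Finsupp.single_mem_supported ℤ 1 (hs n v i w hw)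

end VertexChain

end

noncomputable section

namespace SingularChain

open VertexChain

/-- The standard topological simplex. -/
abbrev Simplex (n : ℕ) := stdSimplex ℝ (Fin (n + 1))

/-! ### Affine maps between standard simplices -/

/-- The affine map with prescribed values on the vertices. -/
def affineMap {n N : ℕ} (v : Fin (n + 1) → Simplex N) : C(Simplex n, Simplex N) where
  toFun t := ⟨∑ j, t.1 j • (v j).1,
    (convex_stdSimplex ℝ _).sum_mem (fun j _ => t.2.1 j) t.2.2 fun j _ => (v j).2⟩
  continuous_toFun := by
    refine Continuous.subtype_mk (continuous_finsetSum _ fun j _ => ?_) _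
    exact ((continuous_apply j).comp continuous_subtype_val).smul continuous_const

/-- The vertices of the standard simplex. -/
abbrev vertices (n : ℕ) : Fin (n + 1) → Simplex n := fun i => stdSimplex.vertex i

lemma affineMap_apply_val {n N : ℕ} (v : Fin (n + 1) → Simplex N) (t : Simplex n) :
    (affineMap v t).1 = ∑ j, t.1 j • (v j).1 := rfl

@[simp] lemma affineMap_vertex {n N : ℕ} (v : Fin (n + 1) → Simplex N) (i : Fin (n + 1)) :
    affineMap v (stdSimplex.vertex i) = v i := by
  refine Subtype.ext ?_
  rw [affineMap_apply_val, Finset.sum_eq_single i]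
  · simp
  · intro j _ hj
    simp [Pi.single_eq_of_ne hj]
  · simp

lemma affineMap_comp_vertices {n N : ℕ} (v : Fin (n + 1) → Simplex N) :
    affineMap v ∘ vertices n = v := funext fun i => affineMap_vertex v i

lemma affineMap_vertices (n : ℕ) : affineMap (vertices n) = ContinuousMap.id _ := by
  ext t : 1
  refine Subtype.ext ?_
  rw [affineMap_apply_val]
  funext i
  simp [Finset.sum_apply, Pi.single_apply]

lemma affineMap_affineMap {n N m : ℕ} (v : Fin (n + 1) → Simplex N) (u : Fin (N + 1) → Simplex m)
    (t : Simplex n) : affineMap u (affineMap v t) = affineMap (affineMap u ∘ v) t := by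
  refine Subtype.ext ?_
  simp only [affineMap_apply_val, Function.comp_apply, Finset.sum_apply, Finset.smul_sum,
    Finset.sum_smul, Pi.smul_apply]
  rw [Finset.sum_comm]
  simp only [smul_eq_mul, smul_smul]

lemma affineMap_comp_affineMap {n N m : ℕ} (v : Fin (n + 1) → Simplex N)
    (u : Fin (N + 1) → Simplex m) :
    (affineMap u).comp (affineMap v) = affineMap (affineMap u ∘ v) :=
  ContinuousMap.ext fun t => affineMap_affineMap v u t

/-- The barycentre of an ordered affine simplex. -/
def bary (N : ℕ) : Centre (Simplex N) := fun _ v => affineMap v stdSimplex.barycenter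

lemma affineMap_bary {N m : ℕ} (u : Fin (N + 1) → Simplex m) (n : ℕ) (v : Fin (n + 1) → Simplex N) :
    affineMap u (bary N n v) = bary m n (affineMap u ∘ v) :=
  affineMap_affineMap v u _

/-- A closed ball containing the vertices contains the affine simplex. -/
lemma dist_affineMap_le {n N : ℕ} {v : Fin (n + 1) → Simplex N} {x : Simplex N} {r : ℝ}
    (h : ∀ i, dist (v i) x ≤ r) (t : Simplex n) : dist (affineMap v t) x ≤ r := by
  have := (convex_closedBall x.1 r).sum_mem (t := Finset.univ)
    (w := t.1) (z := fun j => (v j).1)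
    (fun j _ => t.2.1 j) t.2.2 fun j _ => h j
  exact this

lemma dist_affineMap_affineMap_le {n N : ℕ} {v : Fin (n + 1) → Simplex N} {r : ℝ}
    (h : ∀ i j, dist (v i) (v j) ≤ r) (s t : Simplex n) :
    dist (affineMap v s) (affineMap v t) ≤ r := by
  refine dist_affineMap_le (fun i => ?_) s
  rw [dist_comm]
  exact dist_affineMap_le (fun j => h j i) t

/-- The vector from `v i` to the barycentre is the mean of the `n + 2` vectors `v j - v i`. The one
with `j = i` vanishes and the other `n + 1` have length at most `r`. -/
lemma dist_bary_le {n N : ℕ} {v : Fin (n + 2) → Simplex N} {r : ℝ}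
    (h : ∀ i j, dist (v i) (v j) ≤ r) (i : Fin (n + 2)) :
    dist (bary N (n + 1) v) (v i) ≤ (n + 1) / (n + 2) * r := by
  have hr : 0 ≤ r := dist_nonneg.trans (h 0 0)
  have hn : (0 : ℝ) < n + 2 := by positivity
  have key : (bary N (n + 1) v).1 - (v i).1 = ((n : ℝ) + 2)⁻¹ • ∑ j, ((v j).1 - (v i).1) := by
    rw [bary, affineMap_apply_val, Finset.sum_sub_distrib, smul_sub, Finset.smul_sum]
    congr 1
    · refine Finset.sum_congr rfl fun j _ => ?_
      congr 1
      rw [stdSimplex.barycenter_apply, Fintype.card_fin]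
      push_cast
      ring
    · rw [Finset.sum_const, Finset.card_univ, Fintype.card_fin, ← Nat.cast_smul_eq_nsmul ℝ,
        smul_smul]
      rw [show ((n + 1 + 1 : ℕ) : ℝ) = n + 2 by push_cast; ring, inv_mul_cancel₀ hn.ne', one_smul]
  rw [Subtype.dist_eq, dist_eq_norm, key, norm_smul, Real.norm_of_nonneg (by positivity),
    div_mul_eq_mul_div, inv_mul_eq_div]
  gcongr
  refine (norm_sum_le _ _).trans ?_
  rw [← Finset.add_sum_erase _ _ (Finset.mem_univ i), sub_self, norm_zero, zero_add]
  refine (Finset.sum_le_card_nsmul _ _ r fun j _ => ?_).trans_eq ?_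
  · rw [← dist_eq_norm, ← Subtype.dist_eq]
    exact h j i
  · rw [Finset.card_erase_of_mem (Finset.mem_univ i), Finset.card_univ, Fintype.card_fin,
      nsmul_eq_mul]
    push_cast [Nat.add_sub_cancel]
    simp

/-- The ordered simplices with mutual distances of vertices at most `r`. -/
def meshLE (n N : ℕ) (r : ℝ) : Set (Fin (n + 1) → Simplex N) := {w | ∀ i j, dist (w i) (w j) ≤ r}

/-- The two properties are proved together: containment in balls, applied to the ball about the new
barycentre, bounds the edges at the apex in the mesh estimate. -/
lemma subdivision_single_mem (n N : ℕ) (v : Fin (n + 1) → Simplex N) :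
    subdivision (bary N) n (Finsupp.single v 1) ∈ Finsupp.supported ℤ ℤ
      {w | (∀ r, v ∈ meshLE n N r → w ∈ meshLE n N (n / (n + 1) * r)) ∧
        ∀ x r, (∀ i, dist (v i) x ≤ r) → ∀ j, dist (w j) x ≤ r} := by
  refine subdivision_mem_supported (fun n v => {w | (∀ r, v ∈ meshLE n N r →
    w ∈ meshLE n N (n / (n + 1) * r)) ∧ ∀ x r, (∀ i, dist (v i) x ≤ r) → ∀ j, dist (w j) x ≤ r})
    ?_ ?_ n v
  · intro v
    refine ⟨fun r h i j => ?_, fun x r h => h⟩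
    rw [Subsingleton.elim (α := Fin 1) i j]
    simp
  · intro n v i w hw
    refine ⟨fun r h => ?_, fun x r h => ?_⟩
    · have hr : 0 ≤ r := dist_nonneg.trans (h 0 0)
      have hb : ∀ j, dist (w j) (bary N (n + 1) v) ≤ (n + 1) / (n + 2) * r :=
        hw.2 _ _ fun j => by rw [dist_comm]; exact dist_bary_le h _
      -- Edges away from the apex lie in a subdivided face, whose factor `n / (n + 1)` is smaller
      -- than `(n + 1) / (n + 2)`.
      have hw' : ∀ j k, dist (w j) (w k) ≤ (n + 1) / (n + 2) * r := fun j k => by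
        refine (hw.1 r (fun a b => h _ _) j k).trans ?_
        gcongr ?_ * r
        rw [div_le_div_iff₀ (by positivity) (by positivity)]
        nlinarith
      have e : ((n + 1 : ℕ) : ℝ) / ((n + 1 : ℕ) + 1) = (n + 1) / (n + 2) := by
        push_cast; ring
      rw [e]
      intro a b
      refine Fin.cases ?_ (fun a => ?_) a <;> refine Fin.cases ?_ (fun b => ?_) b
      · simp only [Fin.cons_zero, dist_self]; positivity
      · simp only [Fin.cons_zero, Fin.cons_succ]; rw [dist_comm]; exact hb b
      · simpa only [Fin.cons_zero, Fin.cons_succ] using hb a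
      · simpa only [Fin.cons_succ] using hw' a b
    · intro a
      refine Fin.cases ?_ (fun a => ?_) a
      · simp only [Fin.cons_zero]; exact dist_affineMap_le h _
      · simp only [Fin.cons_succ]; exact hw.2 x r (fun j => h _) a

lemma subdivision_iterate_mem (n N m : ℕ) {r : ℝ} {v : Fin (n + 1) → Simplex N}
    (hv : v ∈ meshLE n N r) :
    (subdivision (bary N) n)^[m] (Finsupp.single v 1) ∈ Finsupp.supported ℤ ℤ
      (meshLE n N ((n / (n + 1)) ^ m * r)) := by
  induction m with
  | zero => simpa using Finsupp.single_mem_supported ℤ (1 : ℤ) hv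
  | succ m ih =>
    rw [Function.iterate_succ_apply']
    refine Finsupp.apply_mem_of_mem_supported (subdivision (bary N) n) _ (fun w hw => ?_) ih
    refine Finsupp.supported_mono ?_ (subdivision_single_mem n N w)
    intro w' hw'
    rw [pow_succ', mul_assoc]
    exact hw'.1 _ hw

/-! ### Singular chains -/

variable {X Y Z : Type*} [TopologicalSpace X] [TopologicalSpace Y] [TopologicalSpace Z]

/-- The free abelian group on the singular simplices. -/
abbrev Chain (n : ℕ) (X : Type*) [TopologicalSpace X] := C(Simplex n, X) →₀ ℤ

/-- The inclusion of a face of the standard simplex. -/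
def coface (n : ℕ) (i : Fin (n + 2)) : C(Simplex n, Simplex (n + 1)) :=
  affineMap (vertices (n + 1) ∘ i.succAbove)

/-- The singular boundary. -/
def d (n : ℕ) : Chain (n + 1) X →ₗ[ℤ] Chain n X :=
  Finsupp.linearCombination ℤ fun σ =>
    ∑ i : Fin (n + 2), ((-1 : ℤ) ^ (i : ℕ)) • Finsupp.single (σ.comp (coface n i)) 1

/-- The chain map induced by a continuous map. -/
def push (n : ℕ) (f : C(X, Y)) : Chain n X →ₗ[ℤ] Chain n Y :=
  Finsupp.lmapDomain ℤ ℤ fun σ => f.comp σ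

/-- The singular chain given by a chain of affine simplices in a singular simplex. -/
def realize (n : ℕ) {N : ℕ} (σ : C(Simplex N, X)) : Chains n (Simplex N) →ₗ[ℤ] Chain n X :=
  Finsupp.lmapDomain ℤ ℤ fun v => σ.comp (affineMap v)

@[simp] lemma d_single (n : ℕ) (σ : C(Simplex (n + 1), X)) :
    d n (Finsupp.single σ 1) =
      ∑ i : Fin (n + 2), ((-1 : ℤ) ^ (i : ℕ)) • Finsupp.single (σ.comp (coface n i)) 1 := by
  simp [d]

@[simp] lemma push_single (n : ℕ) (f : C(X, Y)) (σ : C(Simplex n, X)) :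
    push n f (Finsupp.single σ 1) = Finsupp.single (f.comp σ) 1 := by
  simp [push]

@[simp] lemma realize_single (n : ℕ) {N : ℕ} (σ : C(Simplex N, X)) (v : Fin (n + 1) → Simplex N) :
    realize n σ (Finsupp.single v 1) = Finsupp.single (σ.comp (affineMap v)) 1 := by
  simp [realize]

lemma hom_ext {n : ℕ} {G : Type*} [AddCommGroup G] [Module ℤ G] {f g : Chain n X →ₗ[ℤ] G}
    (h : ∀ σ, f (Finsupp.single σ 1) = g (Finsupp.single σ 1)) : f = g :=
  Finsupp.lhom_ext' fun σ => LinearMap.ext_ring (h σ)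

lemma push_comp (n : ℕ) (g : C(Y, Z)) (f : C(X, Y)) (c : Chain n X) :
    push n (g.comp f) c = push n g (push n f c) := by
  suffices h : push n (g.comp f) = push n g ∘ₗ push n f from LinearMap.congr_fun h c
  exact hom_ext fun σ => by simp [ContinuousMap.comp_assoc]

lemma push_d (n : ℕ) (f : C(X, Y)) (c : Chain (n + 1) X) :
    push n f (d n c) = d n (push (n + 1) f c) := by
  suffices h : push n f ∘ₗ d n = d n ∘ₗ push (n + 1) f from LinearMap.congr_fun h c
  refine hom_ext fun σ => ?_
  simp only [LinearMap.comp_apply, d_single, push_single, map_sum, map_smul,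
    ContinuousMap.comp_assoc]

lemma realize_boundary (n : ℕ) {N : ℕ} (σ : C(Simplex N, X)) (c : Chains (n + 1) (Simplex N)) :
    realize n σ (boundary n c) = d n (realize (n + 1) σ c) := by
  suffices h : realize n σ ∘ₗ boundary n = d n ∘ₗ realize (n + 1) σ from LinearMap.congr_fun h c
  refine VertexChain.hom_ext fun v => ?_
  simp only [LinearMap.comp_apply, boundary_single, realize_single, d_single, map_sum, map_smul,
    ContinuousMap.comp_assoc]
  refine Finset.sum_congr rfl fun i _ => ?_
  rw [coface, affineMap_comp_affineMap, ← Function.comp_assoc, affineMap_comp_vertices]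

lemma realize_map (n : ℕ) {N m : ℕ} (σ : C(Simplex N, X)) (u : Fin (m + 1) → Simplex N)
    (c : Chains n (Simplex m)) :
    realize n σ (map n (affineMap u) c) = realize n (σ.comp (affineMap u)) c := by
  suffices h : realize n σ ∘ₗ map n (affineMap u) = realize n (σ.comp (affineMap u)) from
    LinearMap.congr_fun h c
  refine VertexChain.hom_ext fun v => ?_
  simp only [LinearMap.comp_apply, map_single, realize_single, ContinuousMap.comp_assoc,
    affineMap_comp_affineMap]

/-- Barycentric subdivision of singular chains. -/
def sd (n : ℕ) : Chain n X →ₗ[ℤ] Chain n X :=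
  Finsupp.linearCombination ℤ fun σ =>
    realize n σ (subdivision (bary n) n (Finsupp.single (vertices n) 1))

/-- The natural chain homotopy from barycentric subdivision to the identity. -/
def sdHomotopy (n : ℕ) : Chain n X →ₗ[ℤ] Chain (n + 1) X :=
  Finsupp.linearCombination ℤ fun σ =>
    realize (n + 1) σ (subdivisionHomotopy (bary n) n (Finsupp.single (vertices n) 1))

lemma sd_single (n : ℕ) (σ : C(Simplex n, X)) : sd n (Finsupp.single σ 1) =
    realize n σ (subdivision (bary n) n (Finsupp.single (vertices n) 1)) := by
  simp only [sd, Finsupp.linearCombination_single, one_smul]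

lemma sdHomotopy_single (n : ℕ) (σ : C(Simplex n, X)) : sdHomotopy n (Finsupp.single σ 1) =
    realize (n + 1) σ (subdivisionHomotopy (bary n) n (Finsupp.single (vertices n) 1)) := by
  simp only [sdHomotopy, Finsupp.linearCombination_single, one_smul]

/-- By naturality, subdivision of singular chains inside one `σ` is computed on vertices; this
transfers the identities for vertex chains. -/
lemma sd_realize (n : ℕ) {N : ℕ} (σ : C(Simplex N, X)) (c : Chains n (Simplex N)) :
    sd n (realize n σ c) = realize n σ (subdivision (bary N) n c) := by
  suffices h : sd n ∘ₗ realize n σ = realize n σ ∘ₗ subdivision (bary N) n from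
    LinearMap.congr_fun h c
  refine VertexChain.hom_ext fun v => ?_
  simp only [LinearMap.comp_apply, realize_single, sd_single]
  rw [← realize_map, map_subdivision (affineMap_bary v), map_single, affineMap_comp_vertices]

lemma sdHomotopy_realize (n : ℕ) {N : ℕ} (σ : C(Simplex N, X)) (c : Chains n (Simplex N)) :
    sdHomotopy n (realize n σ c) = realize (n + 1) σ (subdivisionHomotopy (bary N) n c) := by
  suffices h : sdHomotopy n ∘ₗ realize n σ =
      realize (n + 1) σ ∘ₗ subdivisionHomotopy (bary N) n from LinearMap.congr_fun h c
  refine VertexChain.hom_ext fun v => ?_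
  simp only [LinearMap.comp_apply, realize_single, sdHomotopy_single]
  rw [← realize_map, map_subdivisionHomotopy (affineMap_bary v), map_single,
    affineMap_comp_vertices]

lemma single_eq_realize (n : ℕ) (σ : C(Simplex n, X)) :
    (Finsupp.single σ 1 : Chain n X) = realize n σ (Finsupp.single (vertices n) 1) := by
  rw [realize_single, affineMap_vertices, ContinuousMap.comp_id]

lemma d_sd (n : ℕ) (c : Chain (n + 1) X) : d n (sd (n + 1) c) = sd n (d n c) := by
  suffices h : d n ∘ₗ sd (n + 1) = sd n ∘ₗ (d n : Chain (n + 1) X →ₗ[ℤ] _) from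
    LinearMap.congr_fun h c
  refine hom_ext fun σ => ?_
  rw [LinearMap.comp_apply, LinearMap.comp_apply, sd_single, ← realize_boundary,
    boundary_subdivision, ← sd_realize, realize_boundary, ← single_eq_realize]

lemma d_sdHomotopy (n : ℕ) (c : Chain (n + 1) X) :
    d (n + 1) (sdHomotopy (n + 1) c) = c - sd (n + 1) c - sdHomotopy n (d n c) := by
  suffices h : d (n + 1) ∘ₗ sdHomotopy (n + 1) =
      LinearMap.id - sd (n + 1) - sdHomotopy n ∘ₗ (d n : Chain (n + 1) X →ₗ[ℤ] _) from
    LinearMap.congr_fun h c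
  refine hom_ext fun σ => ?_
  simp only [LinearMap.comp_apply, LinearMap.sub_apply, LinearMap.id_apply]
  rw [sdHomotopy_single, ← realize_boundary, boundary_subdivisionHomotopy, map_sub, map_sub,
    ← single_eq_realize, ← sd_realize, ← single_eq_realize, ← sdHomotopy_realize,
    realize_boundary, ← single_eq_realize]

/-! ### Supports -/

/-- The chains supported on simplices whose image has property `P`. -/
def chainsWith (n : ℕ) (P : Set X → Prop) : Submodule ℤ (Chain n X) :=
  Finsupp.supported ℤ ℤ {σ | P (Set.range σ)}

lemma single_mem_chainsWith {n : ℕ} {P : Set X → Prop} {σ : C(Simplex n, X)}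
    (h : P (Set.range σ)) : Finsupp.single σ 1 ∈ chainsWith n P :=
  Finsupp.single_mem_supported ℤ (1 : ℤ) h

lemma chainsWith_mono {n : ℕ} {P Q : Set X → Prop} (h : ∀ s, P s → Q s) :
    (chainsWith n P : Submodule ℤ (Chain n X)) ≤ chainsWith n Q :=
  Finsupp.supported_mono fun _ hσ => h _ hσ

/-- A property inherited by smaller sets. -/
def Hereditary (P : Set X → Prop) : Prop := ∀ s t, s ⊆ t → P t → P s

lemma range_comp_subset (f : C(Y, Z)) (g : C(X, Y)) : Set.range (f.comp g) ⊆ Set.range f :=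
  Set.range_comp_subset_range g f

lemma realize_mem_chainsWith {P : Set X → Prop} (hP : Hereditary P) (n : ℕ) {N : ℕ}
    {σ : C(Simplex N, X)} (hσ : P (Set.range σ)) (c : Chains n (Simplex N)) :
    realize n σ c ∈ chainsWith n P := by
  refine Finsupp.apply_mem_of_mem_supported (realize n σ) _ (s := Set.univ) (fun v _ => ?_) ?_
  · rw [realize_single]
    exact single_mem_chainsWith (hP _ _ (range_comp_subset _ _) hσ)
  · rw [Finsupp.supported_univ]; trivial

lemma sd_mem_chainsWith {P : Set X → Prop} (hP : Hereditary P) {n : ℕ} {c : Chain n X}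
    (hc : c ∈ chainsWith n P) : sd n c ∈ chainsWith n P :=
  Finsupp.apply_mem_of_mem_supported (sd n) _
    (fun σ hσ => by rw [sd_single]; exact realize_mem_chainsWith hP n hσ _) hc

lemma sdHomotopy_mem_chainsWith {P : Set X → Prop} (hP : Hereditary P) {n : ℕ} {c : Chain n X}
    (hc : c ∈ chainsWith n P) : sdHomotopy n c ∈ chainsWith (n + 1) P :=
  Finsupp.apply_mem_of_mem_supported (sdHomotopy n) _
    (fun σ hσ => by rw [sdHomotopy_single]; exact realize_mem_chainsWith hP _ hσ _) hc

/-- Sufficiently fine subdivisions are small with respect to an open cover. -/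
lemma eventually_sd_iterate_mem {ι : Type*} {U : ι → Set X} (hU : ∀ i, IsOpen (U i))
    (hcov : ⋃ i, U i = Set.univ) {n : ℕ} (c : Chain n X) :
    ∀ᶠ m in Filter.atTop, (sd n)^[m] c ∈ chainsWith n fun s => ∃ i, s ⊆ U i := by
  have hsingle : ∀ σ : C(Simplex n, X), ∀ᶠ m in Filter.atTop,
      (sd n)^[m] (Finsupp.single σ 1) ∈ chainsWith n fun s => ∃ i, s ⊆ U i := by
    intro σ
    -- A Lebesgue number for the cover pulled back to the standard simplex; the mesh of the iterated
    -- subdivision eventually drops below it.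
    obtain ⟨δ, hδ, h⟩ := lebesgue_number_lemma_of_metric (s := (Set.univ : Set (Simplex n)))
      isCompact_univ (c := fun i => σ ⁻¹' U i) (fun i => (hU i).preimage σ.continuous)
      (by rw [← Set.preimage_iUnion, hcov, Set.preimage_univ])
    have hlim : Filter.Tendsto (fun m : ℕ => ((n : ℝ) / (n + 1)) ^ m *
        Metric.diam (Set.univ : Set (Simplex n))) Filter.atTop
        (𝓝 (0 * Metric.diam (Set.univ : Set (Simplex n)))) := by
      refine Filter.Tendsto.mul_const _ (tendsto_pow_atTop_nhds_zero_of_lt_one (by positivity) ?_)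
      rw [div_lt_one (by positivity)]
      linarith
    rw [zero_mul] at hlim
    filter_upwards [hlim.eventually_lt_const hδ] with m hm
    have hit : (sd n)^[m] (Finsupp.single σ 1) =
        realize n σ ((subdivision (bary n) n)^[m] (Finsupp.single (vertices n) 1)) := by
      rw [single_eq_realize]
      clear hm
      induction m with
      | zero => rfl
      | succ m ih => rw [Function.iterate_succ_apply', Function.iterate_succ_apply', ih, sd_realize]
    rw [hit]
    refine Finsupp.apply_mem_of_mem_supported (realize n σ) _ (fun w hw => ?_)
      (subdivision_iterate_mem n n m (r := Metric.diam (Set.univ : Set (Simplex n)))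
        fun i j => Metric.dist_le_diam_of_mem isCompact_univ.isBounded (Set.mem_univ _)
          (Set.mem_univ _))
    rw [realize_single]
    refine single_mem_chainsWith ?_
    obtain ⟨i, hi⟩ := h (affineMap w (vertices n 0)) (Set.mem_univ _)
    refine ⟨i, ?_⟩
    rintro _ ⟨t, rfl⟩
    exact hi ((dist_affineMap_affineMap_le hw _ _).trans_lt hm)
  induction c using Finsupp.induction_linear with
  | zero =>
    refine Filter.Eventually.of_forall fun m => ?_
    rw [← Module.End.pow_apply, map_zero]
    exact Submodule.zero_mem _
  | add f g hf hg =>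
    filter_upwards [hf, hg] with m h1 h2
    rw [← Module.End.pow_apply] at *
    rw [map_add]
    exact Submodule.add_mem _ h1 h2
  | single σ k =>
    filter_upwards [hsingle σ] with m h1
    rw [← Module.End.pow_apply] at *
    rw [← mul_one k, ← smul_eq_mul, ← Finsupp.smul_single, map_smul]
    exact Submodule.smul_mem _ _ h1

end SingularChain

end

noncomputable section

namespace SingularChain

variable {X : Type*} [TopologicalSpace X]

/-! ### Relative boundaries -/

/-- The chains which become boundaries relative to `A`. -/
def relBoundaries (n : ℕ) (A : Set X) : Submodule ℤ (Chain n X) :=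
  LinearMap.range (d n) ⊔ chainsWith n (· ⊆ A)

lemma d_mem_relBoundaries {n : ℕ} (A : Set X) (c : Chain (n + 1) X) :
    d n c ∈ relBoundaries n A :=
  Submodule.mem_sup_left ⟨c, rfl⟩

lemma chainsWith_le_relBoundaries (n : ℕ) (A : Set X) :
    chainsWith n (· ⊆ A) ≤ relBoundaries n A := le_sup_right

lemma d_sd_iterate_eq_zero {n : ℕ} {c : Chain (n + 1) X} (hc : d n c = 0) (m : ℕ) :
    d n ((sd (n + 1))^[m] c) = 0 := by
  induction m with
  | zero => exact hc
  | succ m ih => rw [Function.iterate_succ_apply', d_sd, ih, map_zero]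

lemma sub_sd_mem_range {n : ℕ} {c : Chain (n + 1) X} (hc : d n c = 0) :
    d (n + 1) (sdHomotopy (n + 1) c) = c - sd (n + 1) c := by
  rw [d_sdHomotopy, hc, map_zero, sub_zero]

lemma sub_sd_iterate_mem_range {n : ℕ} {c : Chain (n + 1) X} (hc : d n c = 0) (m : ℕ) :
    c - (sd (n + 1))^[m] c ∈ LinearMap.range (d (n + 1) : Chain (n + 2) X →ₗ[ℤ] _) := by
  induction m with
  | zero => simp
  | succ m ih =>
    rw [Function.iterate_succ_apply', ← sub_add_sub_cancel _ ((sd (n + 1))^[m] c)]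
    exact Submodule.add_mem _ ih ⟨_, sub_sd_mem_range (d_sd_iterate_eq_zero hc m)⟩

lemma isClosed_range_simplex [T2Space X] {n : ℕ} (σ : C(Simplex n, X)) :
    IsClosed (Set.range σ) :=
  (isCompact_range σ.continuous).isClosed

/-- The boundary part does not depend on the point. The rest consists of finitely many simplices
with closed images missing `x`, which also miss nearby points. -/
lemma eventually_mem_relBoundaries [T2Space X] {n : ℕ} {x : X} {c : Chain n X}
    (hc : c ∈ relBoundaries n ({x}ᶜ : Set X)) :
    ∀ᶠ y in 𝓝 x, c ∈ relBoundaries n ({y}ᶜ : Set X) := by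
  obtain ⟨b, hb, a, ha, rfl⟩ := Submodule.mem_sup.1 hc
  have : ∀ᶠ y in 𝓝 x, ∀ σ ∈ a.support, Set.range σ ⊆ ({y}ᶜ : Set X) := by
    rw [Filter.eventually_all_finset]
    intro σ hσ
    have hx : x ∈ (Set.range σ)ᶜ := fun h => ha hσ h rfl
    filter_upwards [(isClosed_range_simplex σ).isOpen_compl.mem_nhds hx] with y hy
    rw [Set.subset_compl_singleton_iff]
    exact hy
  filter_upwards [this] with y hy
  exact Submodule.add_mem_sup hb hy

/-! ### Local parts of chains over a point -/

variable {E M : Type*} [TopologicalSpace E] [TopologicalSpace M] (p : C(E, M))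

/-- A set is thin over `x` if it meets the fibre over `x` in at most one point. -/
def Thin (x : M) (s : Set E) : Prop := ∀ a ∈ s, ∀ b ∈ s, p a = x → p b = x → a = b

lemma hereditary_thin (x : M) : Hereditary (Thin p x) :=
  fun _ _ h ht a ha b hb => ht a (h ha) b (h hb)

open scoped Classical in
/-- The image in `M` of the part of a chain consisting of the simplices through `y`. -/
def localPart (n : ℕ) (y : E) : Chain n E →ₗ[ℤ] Chain n M :=
  Finsupp.linearCombination ℤ fun σ =>
    if y ∈ Set.range σ then Finsupp.single (p.comp σ) 1 else 0

variable {p}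

lemma localPart_single_of_mem {n : ℕ} {y : E} {σ : C(Simplex n, E)} (h : y ∈ Set.range σ) :
    localPart p n y (Finsupp.single σ 1) = Finsupp.single (p.comp σ) 1 := by
  rw [localPart, Finsupp.linearCombination_single, if_pos h, one_smul]

lemma localPart_single_of_notMem {n : ℕ} {y : E} {σ : C(Simplex n, E)} (h : y ∉ Set.range σ) :
    localPart p n y (Finsupp.single σ 1) = 0 := by
  rw [localPart, Finsupp.linearCombination_single, if_neg h, smul_zero]

lemma range_comp_subset_compl {n : ℕ} {x : M} {σ : C(Simplex n, E)}
    (h : ∀ a ∈ Set.range σ, p a ≠ x) : Set.range (p.comp σ) ⊆ ({x}ᶜ : Set M) := by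
  rintro _ ⟨t, rfl⟩
  exact h _ ⟨t, rfl⟩

/-- The defect of `localPart` as a chain map comes from faces that miss `y` of simplices through
`y`. By thinness such a face misses the whole fibre of `p y`, so its projection avoids `p y`. -/
lemma d_localPart_sub_mem {n : ℕ} {y : E} {c : Chain (n + 1) E}
    (hc : c ∈ chainsWith (n + 1) (Thin p (p y))) :
    d n (localPart p (n + 1) y c) - localPart p n y (d n c) ∈
      chainsWith n (· ⊆ ({p y}ᶜ : Set M)) := by
  refine Finsupp.apply_mem_of_mem_supported
    (d n ∘ₗ localPart p (n + 1) y - localPart p n y ∘ₗ d n) _ (fun σ hσ => ?_) hc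
  simp only [LinearMap.sub_apply, LinearMap.comp_apply, d_single, map_sum, map_smul]
  by_cases hy : y ∈ Set.range σ
  · rw [localPart_single_of_mem hy, d_single, ← Finset.sum_sub_distrib]
    refine Submodule.sum_mem _ fun i _ => ?_
    rw [← smul_sub]
    refine Submodule.smul_mem _ _ ?_
    by_cases hi : y ∈ Set.range (σ.comp (coface n i))
    · rw [localPart_single_of_mem hi, ContinuousMap.comp_assoc, sub_self]
      exact Submodule.zero_mem _
    · rw [localPart_single_of_notMem hi, sub_zero]
      refine single_mem_chainsWith (range_comp_subset_compl (p := p)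
        (σ := σ.comp (coface n i)) fun a ha hpa => hi ?_)
      have ha' := range_comp_subset σ (coface n i) ha
      rwa [← hσ a ha' y hy hpa rfl]
  · rw [localPart_single_of_notMem hy, map_zero, zero_sub]
    refine Submodule.neg_mem _ (Submodule.sum_mem _ fun i _ => Submodule.smul_mem _ _ ?_)
    rw [localPart_single_of_notMem fun h => hy (range_comp_subset _ _ h)]
    exact Submodule.zero_mem _

lemma finite_setOf_mem_range {n : ℕ} {x : M} {c : Chain n E} (hc : c ∈ chainsWith n (Thin p x)) :
    {y | p y = x ∧ ∃ σ ∈ c.support, y ∈ Set.range σ}.Finite := by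
  have : (⋃ σ ∈ c.support, Set.range σ ∩ p ⁻¹' {x}).Finite :=
    c.support.finite_toSet.biUnion fun σ hσ => Set.Subsingleton.finite
      fun a ha b hb => hc hσ a ha.1 b hb.1 ha.2 hb.2
  refine this.subset ?_
  rintro y ⟨hy, σ, hσ, h⟩
  exact Set.mem_biUnion hσ ⟨h, hy⟩

lemma localPart_eq_zero {n : ℕ} {y : E} {c : Chain n E}
    (h : ∀ σ ∈ c.support, y ∉ Set.range σ) : localPart p n y c = 0 := by
  have : localPart p n y c ∈ (⊥ : Submodule ℤ (Chain n M)) :=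
    Finsupp.apply_mem_of_mem_supported (localPart p n y) ⊥ (s := c.support)
      (fun σ hσ => by rw [localPart_single_of_notMem (h σ hσ)]; exact Submodule.zero_mem _)
      (fun σ hσ => hσ)
  exact this

/-- A thin simplex that meets the fibre contributes to exactly one local part; the other simplices
project into the complement of `x`. -/
lemma push_sub_sum_localPart_mem {n : ℕ} {x : M} {c : Chain n E} {S : Finset E}
    (hc : c ∈ chainsWith n (Thin p x)) (hS : ∀ y, y ∈ S ↔ p y = x ∧ ∃ σ ∈ c.support,
      y ∈ Set.range σ) :
    push n p c - ∑ y ∈ S, localPart p n y c ∈ chainsWith n (· ⊆ ({x}ᶜ : Set M)) := by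
  have := Finsupp.apply_mem_of_mem_supported (push n p - ∑ y ∈ S, localPart p n y)
    (chainsWith n (· ⊆ ({x}ᶜ : Set M))) (s := c.support) (fun σ hσ => ?_) (c := c)
    (fun σ hσ => hσ)
  · simpa [LinearMap.sum_apply] using this
  · simp only [LinearMap.sub_apply, push_single, LinearMap.sum_apply]
    by_cases h : ∃ y ∈ Set.range σ, p y = x
    · obtain ⟨y, hy, rfl⟩ := h
      rw [Finset.sum_eq_single y, localPart_single_of_mem hy, sub_self]
      · exact Submodule.zero_mem _
      · intro b hb hby
        exact localPart_single_of_notMem fun hb' =>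
          hby (hc hσ b hb' y hy ((hS b).1 hb).1 rfl)
      · intro h
        exact absurd ((hS y).2 ⟨rfl, σ, hσ, hy⟩) h
    · push Not at h
      rw [Finset.sum_eq_zero, sub_zero]
      · exact single_mem_chainsWith (range_comp_subset_compl h)
      · intro b hb
        exact localPart_single_of_notMem fun hb' => h b hb' ((hS b).1 hb).1

/-- Local injectivity makes the fibre discrete, so the complement of the fibre together with one
point `y` of `E` is open. These sets cover `E`, and every subset of one of them is thin. -/
lemma eventually_thin [T1Space M] (hp : ∀ y, ∃ W ∈ 𝓝 y, Set.InjOn p W) (x : M) {n : ℕ}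
    (c : Chain n E) : ∀ᶠ m in Filter.atTop, (sd n)^[m] c ∈ chainsWith n (Thin p x) := by
  have hU : ∀ y : E, IsOpen {w : E | p w ≠ x ∨ w = y} := by
    intro y
    rw [isOpen_iff_mem_nhds]
    intro w hw
    by_cases hwx : p w = x
    · obtain ⟨W, hW, hinj⟩ := hp w
      filter_upwards [hW] with b hb
      by_contra hcon
      push Not at hcon
      obtain rfl : w = y := hw.resolve_left fun h => h hwx
      exact hcon.2 (hinj hb (mem_of_mem_nhds hW) (hcon.1.trans hwx.symm))
    · filter_upwards [p.continuous.continuousAt.eventually_ne hwx] with b hb using Or.inl hb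
  filter_upwards [eventually_sd_iterate_mem hU
    (Set.eq_univ_of_forall fun w => Set.mem_iUnion.2 ⟨w, Or.inr rfl⟩) c] with m hm
  refine chainsWith_mono (fun s hs => ?_) hm
  obtain ⟨y, hy⟩ := hs
  intro a ha b hb hax hbx
  rw [(hy ha).resolve_left fun h => h hax, (hy hb).resolve_left fun h => h hbx]

/-- The chain homotopy preserves thinness, so the local part of its boundary is, modulo chains
avoiding `p y`, the boundary of its local part. -/
lemma localPart_sub_localPart_sd_mem {n : ℕ} {y : E} {c : Chain (n + 1) E} (hd : d n c = 0)
    (hc : c ∈ chainsWith (n + 1) (Thin p (p y))) :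
    localPart p (n + 1) y c - localPart p (n + 1) y (sd (n + 1) c) ∈
      relBoundaries (n + 1) ({p y}ᶜ : Set M) := by
  rw [← map_sub, ← sub_sd_mem_range hd]
  have h := d_localPart_sub_mem (sdHomotopy_mem_chainsWith (hereditary_thin p (p y)) hc)
  have h2 := Submodule.sub_mem _ (d_mem_relBoundaries ({p y}ᶜ : Set M)
    (localPart p (n + 1 + 1) y (sdHomotopy (n + 1) c))) (chainsWith_le_relBoundaries _ _ h)
  rwa [sub_sub_cancel] at h2

lemma sd_iterate_mem_thin {n : ℕ} {x : M} {c : Chain n E} (hc : c ∈ chainsWith n (Thin p x))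
    (j : ℕ) : (sd n)^[j] c ∈ chainsWith n (Thin p x) := by
  induction j with
  | zero => exact hc
  | succ j ih =>
    rw [Function.iterate_succ_apply']
    exact sd_mem_chainsWith (hereditary_thin p x) ih

lemma localPart_sub_localPart_sd_iterate_mem {n : ℕ} {y : E} {c : Chain (n + 1) E}
    (hd : d n c = 0) (hc : c ∈ chainsWith (n + 1) (Thin p (p y))) (j : ℕ) :
    localPart p (n + 1) y c - localPart p (n + 1) y ((sd (n + 1))^[j] c) ∈
      relBoundaries (n + 1) ({p y}ᶜ : Set M) := by
  induction j with
  | zero => simp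
  | succ j ih =>
    rw [Function.iterate_succ_apply',
      ← sub_add_sub_cancel _ (localPart p (n + 1) y ((sd (n + 1))^[j] c))]
    exact Submodule.add_mem _ ih (localPart_sub_localPart_sd_mem (d_sd_iterate_eq_zero hd j)
      (sd_iterate_mem_thin hc j))

lemma localPart_sd_iterate_sub_mem {n : ℕ} {y : E} {c : Chain (n + 1) E} (hd : d n c = 0)
    {i j : ℕ} (hi : (sd (n + 1))^[i] c ∈ chainsWith (n + 1) (Thin p (p y)))
    (hj : (sd (n + 1))^[j] c ∈ chainsWith (n + 1) (Thin p (p y))) :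
    localPart p (n + 1) y ((sd (n + 1))^[i] c) - localPart p (n + 1) y ((sd (n + 1))^[j] c) ∈
      relBoundaries (n + 1) ({p y}ᶜ : Set M) := by
  wlog hij : i ≤ j generalizing i j
  · rw [← neg_sub]
    exact Submodule.neg_mem _ (this hj hi (le_of_not_ge hij))
  obtain ⟨k, rfl⟩ := Nat.exists_eq_add_of_le' hij
  rw [Function.iterate_add_apply]
  exact localPart_sub_localPart_sd_iterate_mem (d_sd_iterate_eq_zero hd i) hi k

/-! ### Local degrees -/

/-- Chain-level data of an orientation of a manifold of dimension `n + 1`: relative cycles `z x`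
generating the local homology groups freely, which are locally restrictions of one chain. -/
structure LocalGenerators (n : ℕ) (z : M → Chain (n + 1) M) : Prop where
  exists_multiple : ∀ x c, d n c ∈ chainsWith n (· ⊆ ({x}ᶜ : Set M)) →
    ∃ k : ℤ, c - k • z x ∈ relBoundaries (n + 1) ({x}ᶜ : Set M)
  eq_zero : ∀ x (k : ℤ), k • z x ∈ relBoundaries (n + 1) ({x}ᶜ : Set M) → k = 0
  locally : ∀ x, ∃ U ∈ 𝓝 x, ∃ α : Chain (n + 1) M, ∀ y ∈ U,
    α - z y ∈ relBoundaries (n + 1) ({y}ᶜ : Set M)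

variable {n : ℕ} {z : M → Chain (n + 1) M}

variable (p z) in
/-- The cycle `c` has local degree `k` at `y`. -/
def IsLocalDegree (c : Chain (n + 1) E) (y : E) (k : ℤ) : Prop :=
  ∃ m, (sd (n + 1))^[m] c ∈ chainsWith (n + 1) (Thin p (p y)) ∧
    localPart p (n + 1) y ((sd (n + 1))^[m] c) - k • z (p y) ∈
      relBoundaries (n + 1) ({p y}ᶜ : Set M)

/-- The local degree can be read off from any subdivision that is thin over `p y`, not only from the
one that witnesses it. -/
lemma IsLocalDegree.sub_mem {c : Chain (n + 1) E} (hd : d n c = 0) {y : E} {k : ℤ}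
    (h : IsLocalDegree p z c y k) {m : ℕ}
    (hm : (sd (n + 1))^[m] c ∈ chainsWith (n + 1) (Thin p (p y))) :
    localPart p (n + 1) y ((sd (n + 1))^[m] c) - k • z (p y) ∈
      relBoundaries (n + 1) ({p y}ᶜ : Set M) := by
  obtain ⟨i, hi, h⟩ := h
  rw [← sub_add_sub_cancel]
  exact Submodule.add_mem _ (localPart_sd_iterate_sub_mem hd hm hi) h

lemma IsLocalDegree.unique (hz : LocalGenerators n z) {c : Chain (n + 1) E} (hd : d n c = 0)
    {y : E} {k l : ℤ} (hk : IsLocalDegree p z c y k) (hl : IsLocalDegree p z c y l) : k = l := by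
  obtain ⟨m, hm, h⟩ := hl
  have := Submodule.sub_mem _ h (hk.sub_mem hd hm)
  rw [sub_sub_sub_cancel_left, ← sub_smul] at this
  exact sub_eq_zero.1 (hz.eq_zero _ _ this)

lemma exists_isLocalDegree [T1Space M] (hp : ∀ y, ∃ W ∈ 𝓝 y, Set.InjOn p W)
    (hz : LocalGenerators n z) {c : Chain (n + 1) E} (hd : d n c = 0) (y : E) :
    ∃ k, IsLocalDegree p z c y k := by
  obtain ⟨m, hm⟩ := (eventually_thin hp (p y) c).exists
  have := d_localPart_sub_mem hm
  rw [d_sd_iterate_eq_zero hd, map_zero, sub_zero] at this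
  obtain ⟨k, hk⟩ := hz.exists_multiple _ _ this
  exact ⟨k, m, hm, hk⟩

/-- A map from a compact space to a Hausdorff space is closed, so a neighbourhood of a fibre
contains all nearby fibres. -/
lemma eventually_mem_of_mem_fibre [T2Space M] {K : Type*} [TopologicalSpace K] [CompactSpace K]
    (f : C(K, M)) {x : M} {V : Set K} (hV : IsOpen V) (h : ∀ t, f t = x → t ∈ V) :
    ∀ᶠ x' in 𝓝 x, ∀ t, f t = x' → t ∈ V := by
  have hcl : IsClosed (f '' Vᶜ) := (hV.isClosed_compl.isCompact.image f.continuous).isClosed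
  have hx : x ∈ (f '' Vᶜ)ᶜ := by
    rintro ⟨t, ht, rfl⟩
    exact ht (h t rfl)
  filter_upwards [hcl.isOpen_compl.mem_nhds hx] with x' hx' t ht
  by_contra hcon
  exact hx' ⟨t, hcon, ht⟩

/-- If the simplex meets the fibre of `x` at one point, its points over nearby `x'` stay in a
neighbourhood of that point on which `p` is injective. -/
lemma eventually_range_thin [T2Space M] (hp : ∀ y, ∃ W ∈ 𝓝 y, Set.InjOn p W) {x : M} {m : ℕ}
    {σ : C(Simplex m, E)} (hσ : Thin p x (Set.range σ)) :
    ∀ᶠ x' in 𝓝 x, Thin p x' (Set.range σ) := by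
  by_cases h : ∃ t, p (σ t) = x
  · obtain ⟨t, ht⟩ := h
    obtain ⟨W, hW, hinj⟩ := hp (σ t)
    filter_upwards [eventually_mem_of_mem_fibre (p.comp σ) (isOpen_interior.preimage σ.continuous)
      (V := σ ⁻¹' interior W) (x := x) fun s hs => by
        rw [Set.mem_preimage, hσ (σ s) ⟨s, rfl⟩ (σ t) ⟨t, rfl⟩ hs ht]
        exact mem_interior_iff_mem_nhds.2 hW] with x' hx'
    rintro _ ⟨a, rfl⟩ _ ⟨b, rfl⟩ ha hb
    exact hinj (interior_subset (hx' a ha)) (interior_subset (hx' b hb)) (ha.trans hb.symm)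
  · filter_upwards [eventually_mem_of_mem_fibre (p.comp σ) isOpen_empty (x := x)
      fun s hs => h ⟨s, hs⟩] with x' hx'
    rintro _ ⟨a, rfl⟩ _ _ ha
    exact absurd ha fun h => hx' a h

lemma eventually_localPart_single_sub_mem [T2Space M] [T2Space E]
    (hp : ∀ y, ∃ W ∈ 𝓝 y, Set.InjOn p W) {y : E} {m : ℕ} {σ : C(Simplex m, E)}
    (hσ : Thin p (p y) (Set.range σ)) :
    ∀ᶠ y' in 𝓝 y, localPart p m y' (Finsupp.single σ 1) - localPart p m y (Finsupp.single σ 1) ∈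
      chainsWith m (· ⊆ ({p y'}ᶜ : Set M)) := by
  by_cases hy : y ∈ Set.range σ
  · obtain ⟨W, hW, hinj⟩ := hp y
    have := eventually_mem_of_mem_fibre (p.comp σ) (isOpen_interior.preimage σ.continuous)
      (V := σ ⁻¹' interior W) (x := p y) fun s hs => by
        rw [Set.mem_preimage, hσ (σ s) ⟨s, rfl⟩ y hy hs rfl]
        exact mem_interior_iff_mem_nhds.2 hW
    filter_upwards [hW, p.continuous.continuousAt.eventually this] with y' hy' h
    rw [localPart_single_of_mem hy]
    by_cases hy'' : y' ∈ Set.range σ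
    · rw [localPart_single_of_mem hy'', sub_self]
      exact Submodule.zero_mem _
    · rw [localPart_single_of_notMem hy'', zero_sub]
      refine Submodule.neg_mem _ (single_mem_chainsWith (range_comp_subset_compl ?_))
      rintro _ ⟨t, rfl⟩ ht
      exact hy'' ⟨t, hinj (interior_subset (h t ht)) hy' ht⟩
  · filter_upwards [(isClosed_range_simplex σ).isOpen_compl.mem_nhds hy] with y' hy'
    rw [localPart_single_of_notMem hy, localPart_single_of_notMem hy', sub_self]
    exact Submodule.zero_mem _

/-- Local constancy: one chain `α` represents `z` at all points near `p y`, and for `y'` near `y`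
the same subdivision stays thin, its local part changes only away from `p y'`, and the relation
between local part and `k • α` persists. -/
lemma IsLocalDegree.eventually [T2Space M] [T2Space E] (hp : ∀ y, ∃ W ∈ 𝓝 y, Set.InjOn p W)
    (hz : LocalGenerators n z) {c : Chain (n + 1) E} {y : E} {k : ℤ}
    (h : IsLocalDegree p z c y k) : ∀ᶠ y' in 𝓝 y, IsLocalDegree p z c y' k := by
  obtain ⟨m, hm, h⟩ := h
  set R := (sd (n + 1))^[m] c
  obtain ⟨U, hU, α, hα⟩ := hz.locally (p y)
  have hR : localPart p (n + 1) y R - k • α ∈ relBoundaries (n + 1) ({p y}ᶜ : Set M) := by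
    have := Submodule.sub_mem _ h (Submodule.smul_mem _ k (hα _ (mem_of_mem_nhds hU)))
    rwa [smul_sub, sub_sub_sub_cancel_right] at this
  have hpc := p.continuous.continuousAt (x := y)
  have h1 : ∀ᶠ y' in 𝓝 y, ∀ σ ∈ R.support, Thin p (p y') (Set.range σ) := by
    rw [Filter.eventually_all_finset]
    exact fun σ hσ => hpc.eventually (eventually_range_thin hp (hm hσ))
  have h2 : ∀ᶠ y' in 𝓝 y, ∀ σ ∈ R.support, localPart p (n + 1) y' (Finsupp.single σ 1) -
      localPart p (n + 1) y (Finsupp.single σ 1) ∈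
        chainsWith (n + 1) (· ⊆ ({p y'}ᶜ : Set M)) := by
    rw [Filter.eventually_all_finset]
    exact fun σ hσ => eventually_localPart_single_sub_mem hp (hm hσ)
  filter_upwards [h1, h2, hpc.eventually (eventually_mem_relBoundaries hR), hpc hU]
    with y' h1 h2 h3 h4
  refine ⟨m, h1, ?_⟩
  have h5 : localPart p (n + 1) y' R - localPart p (n + 1) y R ∈
      chainsWith (n + 1) (· ⊆ ({p y'}ᶜ : Set M)) :=
    Finsupp.apply_mem_of_mem_supported (localPart p (n + 1) y' - localPart p (n + 1) y) _
      (s := R.support) h2 (fun σ hσ => hσ)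
  have h6 := Submodule.add_mem _ (Submodule.add_mem _ (chainsWith_le_relBoundaries _ _ h5) h3)
    (Submodule.smul_mem _ k (hα _ h4))
  rwa [sub_add_sub_cancel, smul_sub, sub_add_sub_cancel] at h6

/-- A cycle in a connected space which is spread over infinitely many sheets near some point maps
to zero in the local homology. -/
theorem push_mem_relBoundaries_of_infinite_fibre [T2Space M] [T2Space E] [PreconnectedSpace E]
    (hp : ∀ y, ∃ W ∈ 𝓝 y, Set.InjOn p W) (hz : LocalGenerators n z) {c : Chain (n + 1) E}
    (hd : d n c = 0) {x : M} (hx : (p ⁻¹' {x}).Infinite) :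
    push (n + 1) p c ∈ relBoundaries (n + 1) ({x}ᶜ : Set M) := by
  choose k hk using exists_isLocalDegree hp hz hd
  have hlc : IsLocallyConstant k := (IsLocallyConstant.iff_eventually_eq k).2 fun y =>
    ((hk y).eventually hp hz).mono fun y' hy' => (hk y').unique hz hd hy'
  obtain ⟨m, hm⟩ := (eventually_thin hp x c).exists
  have hfin := finite_setOf_mem_range hm
  -- The thin chain meets the fibre in finitely many points, so an infinite fibre has a point
  -- through which no simplex passes.
  obtain ⟨y₀, hy₀, hy₀'⟩ := (hx.sdiff hfin).nonempty
  have hy₀x : p y₀ = x := hy₀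
  have hk0 : k y₀ = 0 := by
    refine (hk y₀).unique hz hd ⟨m, by rwa [hy₀x], ?_⟩
    rw [localPart_eq_zero fun σ hσ h => hy₀' ⟨hy₀, σ, hσ, h⟩, zero_smul, sub_zero]
    exact Submodule.zero_mem _
  have hall : ∀ y, k y = 0 := fun y => (hlc.apply_eq_of_preconnectedSpace y y₀).trans hk0
  have hS := push_sub_sum_localPart_mem (S := hfin.toFinset) hm fun y => hfin.mem_toFinset
  have hsum : ∑ y ∈ hfin.toFinset, localPart p (n + 1) y ((sd (n + 1))^[m] c) ∈
      relBoundaries (n + 1) ({x}ᶜ : Set M) := by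
    refine Submodule.sum_mem _ fun y hy => ?_
    obtain rfl : p y = x := (hfin.mem_toFinset.1 hy).1
    have := (hk y).sub_mem hd hm
    rwa [hall, zero_smul, sub_zero] at this
  have h1 := Submodule.add_mem _ (chainsWith_le_relBoundaries _ _ hS) hsum
  rw [sub_add_cancel] at h1
  -- The vanishing was obtained for the subdivided cycle; it differs from `c` by a boundary.
  obtain ⟨w, hw⟩ := sub_sd_iterate_mem_range hd m
  have h2 := Submodule.add_mem _ (d_mem_relBoundaries ({x}ᶜ : Set M) (push (n + 1 + 1) p w)) h1
  rwa [← push_d, hw, map_sub, sub_add_cancel] at h2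

end SingularChain

end

/-! ### Comparison of free singular chains with the singular chain complex -/

noncomputable section

namespace SingularChain

open GammaManifold Simplicial

variable {X Y : Type u} [TopologicalSpace X] [TopologicalSpace Y]

/-- The coefficients. -/
abbrev coeff : ModuleCat.{u} ℤ := ModuleCat.of ℤ (ULift.{u} ℤ)

/-- Singular simplices as elements of the singular simplicial set. -/
def simplexEquiv (n : ℕ) (X : Type u) [TopologicalSpace X] :
    (TopCat.toSSet.obj (TopCat.of X)) _⦋n⦌ ≃ C(Simplex n, X) :=
  TopCat.toSSetObjEquiv (TopCat.of X) (Opposite.op ⦋n⦌)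

lemma coface_eq (n : ℕ) (i : Fin (n + 2)) (t : Simplex n) :
    coface n i t = stdSimplex.map i.succAbove t := by
  refine Subtype.ext ?_
  funext j
  have h : (stdSimplex.map i.succAbove t).1 j = FunOnFinite.linearMap ℝ ℝ i.succAbove t.1 j := rfl
  rw [h, FunOnFinite.linearMap_apply_apply, coface, affineMap_apply_val, Finset.sum_apply,
    Finset.sum_filter]
  refine Finset.sum_congr rfl fun k _ => ?_
  simp [Pi.single_apply, eq_comm]

lemma simplexEquiv_δ (n : ℕ) (i : Fin (n + 2))
    (x : (TopCat.toSSet.obj (TopCat.of X)) _⦋n + 1⦌) :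
    simplexEquiv n X ((TopCat.toSSet.obj (TopCat.of X)).δ i x) =
      (simplexEquiv (n + 1) X x).comp (coface n i) := by
  ext t
  rw [ContinuousMap.comp_apply, coface_eq]
  rfl

lemma simplexEquiv_map (n : ℕ) (f : C(X, Y)) (x : (TopCat.toSSet.obj (TopCat.of X)) _⦋n⦌) :
    simplexEquiv n Y ((TopCat.toSSet.map (TopCat.ofHom f)).app _ x) =
      f.comp (simplexEquiv n X x) := rfl

/-- The inclusion of the summand of a singular simplex. -/
def summand (n : ℕ) (σ : C(Simplex n, X)) : coeff ⟶ (singularChains X).X n :=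
  (TopCat.toSSet.obj (TopCat.of X)).ιChainComplex (R := coeff) ((simplexEquiv n X).symm σ)

lemma summand_d (n : ℕ) (σ : C(Simplex (n + 1), X)) :
    summand (n + 1) σ ≫ (singularChains X).d (n + 1) n =
      ∑ i : Fin (n + 2), (-1 : ℤ) ^ (i : ℕ) • summand n (σ.comp (coface n i)) := by
  refine (SSet.ιChainComplex_d (R := coeff)
    (TopCat.toSSet.obj (TopCat.of X)) ((simplexEquiv (n + 1) X).symm σ)).trans ?_
  refine Finset.sum_congr rfl fun i _ => ?_
  congr 1
  rw [summand, ← (simplexEquiv (n + 1) X).apply_symm_apply σ, ← simplexEquiv_δ,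
    Equiv.symm_apply_apply, Equiv.symm_apply_apply]

lemma summand_map (n : ℕ) (f : C(X, Y)) (σ : C(Simplex n, X)) :
    summand n σ ≫ (singularChainsMap f).f n = summand n (f.comp σ) := by
  refine (SSet.ι_chainComplexMap_f (R := coeff) (X := TopCat.toSSet.obj (TopCat.of X))
    (Y := TopCat.toSSet.obj (TopCat.of Y))
    (TopCat.toSSet.map (TopCat.ofHom f)) ((simplexEquiv n X).symm σ)).trans ?_
  rw [summand, ← (simplexEquiv n X).apply_symm_apply σ, ← simplexEquiv_map,
    Equiv.symm_apply_apply, Equiv.symm_apply_apply]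

lemma summand_hom_ext {n : ℕ} {G : ModuleCat.{u} ℤ} {f g : (singularChains X).X n ⟶ G}
    (h : ∀ σ, summand n σ ≫ f = summand n σ ≫ g) : f = g :=
  SSet.chainComplex_hom_ext (R := coeff) (X := TopCat.toSSet.obj (TopCat.of X)) fun x => by
    have := h (simplexEquiv n X x)
    rwa [summand, Equiv.symm_apply_apply] at this

/-- The comparison of concrete singular chains with the singular chain complex. -/
def compare (n : ℕ) (X : Type u) [TopologicalSpace X] :
    Chain n X →ₗ[ℤ] (singularChains X).X n :=
  Finsupp.linearCombination ℤ fun σ => (summand n σ).hom (ULift.up 1)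

lemma compare_single (n : ℕ) (σ : C(Simplex n, X)) :
    compare n X (Finsupp.single σ 1) = (summand n σ).hom (ULift.up 1) := by
  rw [compare, Finsupp.linearCombination_single]
  exact @one_smul ℤ _ _ (ModuleCat.isModule _).toMulAction _

lemma compare_d (n : ℕ) (c : Chain (n + 1) X) :
    compare n X (d n c) = ((singularChains X).d (n + 1) n).hom (compare (n + 1) X c) := by
  suffices h : compare n X ∘ₗ d n =
      ((singularChains X).d (n + 1) n).hom ∘ₗ compare (n + 1) X from LinearMap.congr_fun h c
  refine hom_ext fun σ => ?_
  have h := congrArg ModuleCat.Hom.hom (summand_d n σ)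
  rw [ModuleCat.hom_sum] at h
  replace h := LinearMap.congr_fun h (ULift.up 1)
  simp only [LinearMap.comp_apply, d_single, map_sum, compare_single]
  refine Eq.trans ?_ h.symm
  rw [LinearMap.sum_apply]
  refine Finset.sum_congr rfl fun i _ => ?_
  rw [ModuleCat.hom_zsmul]
  refine (map_zsmul (compare n X) _ _).trans ?_
  rw [compare_single]
  rfl

lemma compare_push (n : ℕ) (f : C(X, Y)) (c : Chain n X) :
    compare n Y (push n f c) = ((singularChainsMap f).f n).hom (compare n X c) := by
  suffices h : compare n Y ∘ₗ push n f =
      ((singularChainsMap f).f n).hom ∘ₗ compare n X from LinearMap.congr_fun h c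
  refine hom_ext fun σ => ?_
  have := ConcreteCategory.congr_hom (summand_map n f σ) (ULift.up 1)
  simp only [LinearMap.comp_apply, push_single, compare_single]
  exact this.symm

/-- The inverse comparison. -/
def compareInv (n : ℕ) (X : Type u) [TopologicalSpace X] :
    (singularChains X).X n ⟶ ModuleCat.of ℤ (Chain n X) :=
  Limits.Cofan.IsColimit.desc
    ((TopCat.toSSet.obj (TopCat.of X)).isColimitChainComplexXCofan coeff n) fun x =>
      ModuleCat.ofHom ((Finsupp.lsingle (simplexEquiv n X x)) ∘ₗ
        (ULift.moduleEquiv (R := ℤ) (M := ℤ)).toLinearMap)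

lemma summand_compareInv (n : ℕ) (σ : C(Simplex n, X)) :
    summand n σ ≫ compareInv n X = ModuleCat.ofHom ((Finsupp.lsingle σ) ∘ₗ
        (ULift.moduleEquiv (R := ℤ) (M := ℤ)).toLinearMap) := by
  refine (Limits.Cofan.IsColimit.fac
    ((TopCat.toSSet.obj (TopCat.of X)).isColimitChainComplexXCofan coeff n) _ _).trans ?_
  rw [Equiv.apply_symm_apply]

lemma compareInv_compare (n : ℕ) (c : Chain n X) :
    (compareInv n X).hom (compare n X c) = c := by
  suffices h : (compareInv n X).hom ∘ₗ compare n X = LinearMap.id from LinearMap.congr_fun h c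
  refine hom_ext fun σ => ?_
  rw [LinearMap.comp_apply, compare_single]
  exact ConcreteCategory.congr_hom (summand_compareInv n σ) (ULift.up 1)

lemma compare_compareInv (n : ℕ) (c : (singularChains X).X n) :
    compare n X ((compareInv n X).hom c) = c := by
  suffices h : compareInv n X ≫ ModuleCat.ofHom (compare n X) = 𝟙 _ from
    ConcreteCategory.congr_hom h c
  refine summand_hom_ext fun σ => ?_
  rw [← Category.assoc, summand_compareInv, Category.comp_id]
  ext k
  have h : Finsupp.single σ k.down = k.down • (Finsupp.single σ 1 : Chain n X) := by simp
  change compare n X (Finsupp.single σ k.down) = (summand n σ).hom k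
  rw [h]
  refine ((compare n X).map_smul _ _).trans ?_
  rw [compare_single]
  refine ((summand n σ).hom.map_smul k.down (ULift.up 1)).symm.trans ?_
  congr 1
  exact ULift.ext _ _ (mul_one _)

lemma compare_injective (n : ℕ) : Function.Injective (compare n X) :=
  Function.LeftInverse.injective (compareInv_compare n)

lemma compare_surjective (n : ℕ) : Function.Surjective (compare n X) :=
  Function.RightInverse.surjective (compare_compareInv n)

/-- A simplex with image in `A` factors through the subspace `A`, so support in `A` means coming
from the chains of `A`. -/
lemma mem_chainsWith_iff_compare (n : ℕ) (A : Set X) (c : Chain n X) :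
    c ∈ chainsWith n (· ⊆ A) ↔
      ∃ a, ((singularChainsMap (subspaceInclusion A)).f n).hom a = compare n X c := by
  constructor
  · intro hc
    suffices h : c ∈ LinearMap.range (push n (subspaceInclusion A)) by
      obtain ⟨a, rfl⟩ := h
      exact ⟨compare n A a, (compare_push n _ a).symm⟩
    refine Finsupp.apply_mem_of_mem_supported LinearMap.id _ (fun σ hσ => ?_) hc
    refine ⟨Finsupp.single ⟨fun t => ⟨σ t, hσ ⟨t, rfl⟩⟩, σ.continuous.subtype_mk _⟩ 1, ?_⟩
    rw [push_single]
    rfl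
  · rintro ⟨a, ha⟩
    obtain ⟨a, rfl⟩ := compare_surjective n a
    rw [← compare_push] at ha
    rw [← compare_injective n ha]
    refine Finsupp.apply_mem_of_mem_supported (push n (subspaceInclusion A)) _
      (s := Set.univ) (fun σ _ => ?_) (by rw [Finsupp.supported_univ]; trivial)
    rw [push_single]
    refine single_mem_chainsWith ?_
    rintro _ ⟨t, rfl⟩
    exact (σ t).2

end SingularChain

end

noncomputable section

namespace SingularChain

open GammaManifold

/-! ### Homology classes and cycles -/

section

variable {K L : ChainComplex (ModuleCat.{u} ℤ) ℕ} {n : ℕ}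

/-- The homology class `h` is represented by the cycle `x`. -/
def Represents (K : ChainComplex (ModuleCat.{u} ℤ) ℕ) (n : ℕ) (x : K.X n) (h : K.homology n) :
    Prop :=
  ∃ z : K.cycles n, (K.iCycles n).hom z = x ∧ (K.homologyπ n).hom z = h

lemma exists_represents (h : K.homology n) : ∃ x, Represents K n x h := by
  obtain ⟨z, hz⟩ := (ModuleCat.epi_iff_surjective (K.homologyπ n)).1 inferInstance h
  exact ⟨_, z, rfl, hz⟩

lemma Represents.d_eq_zero {x : K.X (n + 1)} {h : K.homology (n + 1)}
    (hx : Represents K (n + 1) x h) : (K.d (n + 1) n).hom x = 0 := by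
  obtain ⟨z, rfl, -⟩ := hx
  exact ConcreteCategory.congr_hom (K.iCycles_d (n + 1) n) z

lemma exists_represents_of_d_eq_zero {x : K.X (n + 1)} (hx : (K.d (n + 1) n).hom x = 0) :
    ∃ h, Represents K (n + 1) x h := by
  have hn : (ComplexShape.down ℕ).next (n + 1) = n := by simp
  have hex := ShortComplex.exact_of_f_is_kernel
    (ShortComplex.mk (K.iCycles (n + 1)) (K.d (n + 1) n) (by simp)) (K.cyclesIsKernel _ _ hn)
  rw [ShortComplex.moduleCat_exact_iff] at hex
  obtain ⟨z, hz⟩ := hex x hx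
  exact ⟨_, z, hz, rfl⟩

lemma Represents.sub {x y : K.X n} {h k : K.homology n} (hx : Represents K n x h)
    (hy : Represents K n y k) : Represents K n (x - y) (h - k) := by
  obtain ⟨z, rfl, rfl⟩ := hx
  obtain ⟨w, rfl, rfl⟩ := hy
  exact ⟨z - w, map_sub _ _ _, map_sub _ _ _⟩

lemma Represents.zsmul {x : K.X n} {h : K.homology n} (hx : Represents K n x h) (k : ℤ) :
    Represents K n (k • x) (k • h) := by
  obtain ⟨z, rfl, rfl⟩ := hx
  exact ⟨k • z, map_zsmul _ _ _, map_zsmul _ _ _⟩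

lemma Represents.eq_zero_iff {x : K.X n} {h : K.homology n} (hx : Represents K n x h) :
    h = 0 ↔ ∃ w, (K.d (n + 1) n).hom w = x := by
  obtain ⟨z, rfl, rfl⟩ := hx
  have hn : (ComplexShape.down ℕ).prev n = n + 1 := by simp
  have hex := ShortComplex.exact_of_g_is_cokernel
    (ShortComplex.mk (K.toCycles (n + 1) n) (K.homologyπ n) (by simp)) (K.homologyIsCokernel _ _ hn)
  rw [ShortComplex.moduleCat_exact_iff] at hex
  have hi : ∀ w, (K.iCycles n).hom ((K.toCycles (n + 1) n).hom w) = (K.d (n + 1) n).hom w :=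
    fun w => ConcreteCategory.congr_hom (K.toCycles_i (n + 1) n) w
  constructor
  · intro h
    obtain ⟨w, hw⟩ := hex z h
    exact ⟨w, by rw [← hi]; exact congrArg _ hw⟩
  · rintro ⟨w, hw⟩
    rw [← hi] at hw
    have := (ModuleCat.mono_iff_injective (K.iCycles n)).1 inferInstance hw
    rw [← this]
    exact ConcreteCategory.congr_hom (K.toCycles_comp_homologyπ (n + 1) n) w

lemma Represents.map {x : K.X n} {h : K.homology n} (hx : Represents K n x h) (φ : K ⟶ L) :
    Represents L n ((φ.f n).hom x) ((HomologicalComplex.homologyMap φ n).hom h) := by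
  obtain ⟨z, rfl, rfl⟩ := hx
  exact ⟨(HomologicalComplex.cyclesMap φ n).hom z,
    ConcreteCategory.congr_hom (HomologicalComplex.cyclesMap_i φ n) z,
    (ConcreteCategory.congr_hom (HomologicalComplex.homologyπ_naturality φ n) z).symm⟩

end

/-! ### Singular homology classes and concrete cycles -/

variable {X Y : Type u} [TopologicalSpace X] [TopologicalSpace Y] {n : ℕ}

/-- The projection to relative chains. -/
abbrev relProj (X : Type u) [TopologicalSpace X] (A : Set X) :
    singularChains X ⟶ relativeChains X A :=
  Limits.cokernel.π (singularChainsMap (subspaceInclusion A))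

lemma relProj_surjective (A : Set X) (n : ℕ) : Function.Surjective ((relProj X A).f n).hom :=
  (ModuleCat.epi_iff_surjective ((relProj X A).f n)).1 inferInstance

lemma relProj_eq_zero_iff (A : Set X) (n : ℕ) (c : Chain n X) :
    ((relProj X A).f n).hom (compare n X c) = 0 ↔ c ∈ chainsWith n (· ⊆ A) := by
  rw [mem_chainsWith_iff_compare]
  have hex : (ShortComplex.mk (singularChainsMap (subspaceInclusion A)) (relProj X A)
    (Limits.cokernel.condition _)).Exact := ShortComplex.exact_cokernel _
  have hex' := (HomologicalComplex.exact_iff_degreewise_exact _).1 hex n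
  rw [ShortComplex.moduleCat_exact_iff] at hex'
  constructor
  · exact fun h => hex' _ h
  · rintro ⟨a, ha⟩
    rw [← ha]
    exact ConcreteCategory.congr_hom (congrArg (fun φ => φ.f n) (Limits.cokernel.condition
      (singularChainsMap (subspaceInclusion A)))) a

/-- The singular homology class `h` is represented by the cycle `c`. -/
def AbsRepresents (n : ℕ) (c : Chain n X) (h : singularHomology n X) : Prop :=
  Represents (singularChains X) n (compare n X c) h

/-- The relative homology class `h` is represented by the relative cycle `c`. -/
def RelRepresents (n : ℕ) (A : Set X) (c : Chain n X) (h : relativeHomology n X A) : Prop :=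
  Represents (relativeChains X A) n (((relProj X A).f n).hom (compare n X c)) h

lemma exists_absRepresents (h : singularHomology n X) : ∃ c, AbsRepresents n c h := by
  obtain ⟨x, hx⟩ := exists_represents h
  obtain ⟨c, rfl⟩ := compare_surjective n x
  exact ⟨c, hx⟩

lemma exists_relRepresents {A : Set X} (h : relativeHomology n X A) :
    ∃ c, RelRepresents n A c h := by
  obtain ⟨x, hx⟩ := exists_represents h
  obtain ⟨y, rfl⟩ := relProj_surjective A n x
  obtain ⟨c, rfl⟩ := compare_surjective n y
  exact ⟨c, hx⟩

lemma relProj_compare_d (A : Set X) (c : Chain (n + 1) X) :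
    ((relProj X A).f n).hom (compare n X (d n c)) = ((relativeChains X A).d (n + 1) n).hom
      (((relProj X A).f (n + 1)).hom (compare (n + 1) X c)) := by
  rw [compare_d]
  exact (ConcreteCategory.congr_hom ((relProj X A).comm (n + 1) n) (compare (n + 1) X c)).symm

lemma AbsRepresents.d_eq_zero {c : Chain (n + 1) X} {h : singularHomology (n + 1) X}
    (hc : AbsRepresents (n + 1) c h) : d n c = 0 := by
  have := Represents.d_eq_zero hc
  rw [← compare_d] at this
  exact compare_injective n (this.trans (map_zero _).symm)

lemma exists_relRepresents_of_d_mem {A : Set X} {c : Chain (n + 1) X}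
    (hc : d n c ∈ chainsWith n (· ⊆ A)) : ∃ h, RelRepresents (n + 1) A c h := by
  refine exists_represents_of_d_eq_zero ?_
  rwa [← relProj_compare_d, relProj_eq_zero_iff]

lemma AbsRepresents.sub {c c' : Chain n X} {h h' : singularHomology n X}
    (hc : AbsRepresents n c h) (hc' : AbsRepresents n c' h') :
    AbsRepresents n (c - c') (h - h') := by
  rw [AbsRepresents, map_sub]
  exact Represents.sub hc hc'

lemma AbsRepresents.zsmul {c : Chain n X} {h : singularHomology n X} (hc : AbsRepresents n c h)
    (k : ℤ) : AbsRepresents n (k • c) (k • h) := by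
  rw [AbsRepresents, map_zsmul]
  exact Represents.zsmul hc k

lemma RelRepresents.sub {A : Set X} {c c' : Chain n X} {h h' : relativeHomology n X A}
    (hc : RelRepresents n A c h) (hc' : RelRepresents n A c' h') :
    RelRepresents n A (c - c') (h - h') := by
  rw [RelRepresents, map_sub, map_sub]
  exact Represents.sub hc hc'

lemma RelRepresents.zsmul {A : Set X} {c : Chain n X} {h : relativeHomology n X A}
    (hc : RelRepresents n A c h) (k : ℤ) : RelRepresents n A (k • c) (k • h) := by
  rw [RelRepresents, map_zsmul, map_zsmul]
  exact Represents.zsmul hc k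

lemma AbsRepresents.eq_zero_iff {c : Chain n X} {h : singularHomology n X}
    (hc : AbsRepresents n c h) : h = 0 ↔ c ∈ LinearMap.range (d n : Chain (n + 1) X →ₗ[ℤ] _) := by
  rw [Represents.eq_zero_iff hc]
  constructor
  · rintro ⟨w, hw⟩
    obtain ⟨w, rfl⟩ := compare_surjective _ w
    rw [← compare_d] at hw
    exact ⟨w, compare_injective n hw⟩
  · rintro ⟨w, rfl⟩
    exact ⟨_, (compare_d n w).symm⟩

/-- The bridge between vanishing in relative homology and the chain-level condition: lift a bounding
relative chain to `X`; the error lies in the kernel of the projection, which is the chains in `A`.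
-/
lemma RelRepresents.eq_zero_iff {A : Set X} {c : Chain n X} {h : relativeHomology n X A}
    (hc : RelRepresents n A c h) : h = 0 ↔ c ∈ relBoundaries n A := by
  rw [Represents.eq_zero_iff hc, relBoundaries, Submodule.mem_sup]
  constructor
  · rintro ⟨w, hw⟩
    obtain ⟨w, rfl⟩ := relProj_surjective A _ w
    obtain ⟨w, rfl⟩ := compare_surjective _ w
    rw [← relProj_compare_d] at hw
    refine ⟨d n w, ⟨w, rfl⟩, c - d n w, ?_, add_sub_cancel _ _⟩
    rw [← relProj_eq_zero_iff, map_sub, map_sub, hw, sub_self]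
  · rintro ⟨_, ⟨w, rfl⟩, a, ha, rfl⟩
    refine ⟨((relProj X A).f (n + 1)).hom (compare (n + 1) X w), ?_⟩
    rw [← relProj_compare_d, map_add, map_add, (relProj_eq_zero_iff A n a).2 ha, add_zero]

lemma RelRepresents.map {A B : Set X} {c : Chain n X} {h : relativeHomology n X A}
    (hc : RelRepresents n A c h) (hAB : A ⊆ B) :
    RelRepresents n B c ((relativeHomologyMap n hAB).hom h) := by
  have := Represents.map hc (Limits.cokernel.map (singularChainsMap (subspaceInclusion A))
      (singularChainsMap (subspaceInclusion B)) (singularChainsMap (subspaceMap hAB))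
      (𝟙 (singularChains X)) (subspaceMap_comm hAB))
  have e : relProj X A ≫ Limits.cokernel.map (singularChainsMap (subspaceInclusion A))
      (singularChainsMap (subspaceInclusion B)) (singularChainsMap (subspaceMap hAB))
      (𝟙 (singularChains X)) (subspaceMap_comm hAB) = relProj X B := by
    simp [relProj]
  rw [RelRepresents, ← e]
  exact this

lemma AbsRepresents.toRelative {c : Chain n X} {h : singularHomology n X}
    (hc : AbsRepresents n c h) (A : Set X) :
    RelRepresents n A c ((toRelativeHomology n X A).hom h) :=
  Represents.map hc _

lemma AbsRepresents.push {c : Chain n X} {h : singularHomology n X} (hc : AbsRepresents n c h)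
    (f : C(X, Y)) : AbsRepresents n (push n f c) ((singularHomologyMap n f).hom h) := by
  rw [AbsRepresents, compare_push]
  exact Represents.map hc _

end SingularChain

end

/-! ### Orientations at chain level and vanishing of the degree -/

noncomputable section

namespace SingularChain

open GammaManifold

variable {M : Type u} [TopologicalSpace M] {n : ℕ}

/-- For representatives of the local orientations, the three conditions are surjectivity and
injectivity of `k ↦ k • μ_x`, and local consistency. -/
lemma exists_localGenerators (o : Orientation (n + 1) M) :
    ∃ z : M → Chain (n + 1) M, (∀ x, RelRepresents (n + 1) ({x}ᶜ : Set M) (z x) (o.localClass x)) ∧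
      LocalGenerators n z := by
  choose z hz using fun x => exists_relRepresents (o.localClass x)
  refine ⟨z, hz, ⟨fun x c hc => ?_, fun x k hk => ?_, fun x => ?_⟩⟩
  · obtain ⟨h, hh⟩ := exists_relRepresents_of_d_mem hc
    obtain ⟨k, hk⟩ := (o.generator x).2 h
    refine ⟨k, ((hh.sub ((hz x).zsmul k)).eq_zero_iff).1 ?_⟩
    exact sub_eq_zero.2 hk.symm
  · have := (((hz x).zsmul k).eq_zero_iff).2 hk
    exact (o.generator x).1 (this.trans (zero_smul ℤ _).symm)
  · obtain ⟨U, hU, a, ha⟩ := o.consistent x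
    obtain ⟨α, hα⟩ := exists_relRepresents a
    refine ⟨U, hU, α, fun y hy => ?_⟩
    have h := hα.map (Set.compl_subset_compl.mpr (Set.singleton_subset_iff.mpr hy))
    refine ((h.sub (hz y)).eq_zero_iff).1 (sub_eq_zero.2 (ha y hy))

/-- A self-map which lifts to a connected space with an infinite fibre has degree zero. -/
theorem degree_eq_zero_of_lift [T2Space M] (o : Orientation (n + 1) M) {f : C(M, M)} {k : ℤ}
    (hf : HasMappingDegree o f k) {E : Type u} [TopologicalSpace E] [T2Space E]
    [PreconnectedSpace E] {p : C(E, M)} (hp : ∀ y, ∃ W ∈ 𝓝 y, Set.InjOn p W) {g : C(M, E)}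
    (hg : p.comp g = f) {x : M} (hx : (p ⁻¹' {x}).Infinite) : k = 0 := by
  obtain ⟨z, hz, hlg⟩ := exists_localGenerators o
  obtain ⟨h, hfund, hdeg⟩ := hf
  obtain ⟨c, hc⟩ := exists_absRepresents h
  -- The cycle in `E` is the lift by `g` of a fundamental cycle; its projection is the image of that
  -- cycle under `f`.
  have h1 := push_mem_relBoundaries_of_infinite_fibre hp hlg (hc.push g).d_eq_zero hx
  rw [← push_comp, hg] at h1
  have h2 := ((hc.push f).toRelative ({x}ᶜ : Set M)).eq_zero_iff.2 h1
  have h3 : k • o.localClass x = 0 := by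
    rw [← hfund x, ← h2]
    refine Eq.trans ?_ (congrArg (toRelativeHomology (n + 1) M ({x}ᶜ : Set M)).hom hdeg).symm
    exact (map_zsmul (toRelativeHomology (n + 1) M ({x}ᶜ : Set M)).hom k h).symm
  exact (o.generator x).1 (h3.trans (zero_smul ℤ _).symm)

/-- Homotopic maps have the same mapping degrees. -/
lemma _root_.GammaManifold.HasMappingDegree.of_homotopic {m : ℕ} {o : Orientation m M} {f g : C(M, M)} {k : ℤ}
    (hf : HasMappingDegree o f k) (H : f.Homotopy g) : HasMappingDegree o g k := by
  obtain ⟨h, hfund, hdeg⟩ := hf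
  refine ⟨h, hfund, ?_⟩
  rw [← hdeg]
  have H' : TopCat.Homotopy (TopCat.ofHom f) (TopCat.ofHom g) := H
  have := H'.congr_homologyMap_singularChainComplexFunctor coeff m
  exact (ConcreteCategory.congr_hom this h).symm

end SingularChain

end

/-! ### The cover belonging to a subgroup of the fundamental group -/

noncomputable section

namespace SubgroupCover

variable {M : Type u} [TopologicalSpace M] {x₀ : M}

/-- Homotopy classes of paths from the base point, up to the subgroup `H`. -/
def sheetSetoid (H : Subgroup (FundamentalGroup M x₀)) (x : M) :
    Setoid (FundamentalGroupoid.mk x₀ ⟶ FundamentalGroupoid.mk x) where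
  r a b := (a ≫ Groupoid.inv b : FundamentalGroup M x₀) ∈ H
  iseqv := by
    refine ⟨fun a => ?_, fun {a b} h => ?_, fun {a b c} h h' => ?_⟩
    · rw [Groupoid.comp_inv]
      exact H.one_mem
    · have : Groupoid.inv (a ≫ Groupoid.inv b) = b ≫ Groupoid.inv a := by simp
      rw [← this]
      exact H.inv_mem h
    · have : a ≫ Groupoid.inv c = (a ≫ Groupoid.inv b) ≫ (b ≫ Groupoid.inv c) := by simp
      rw [this]
      exact H.mul_mem h' h

/-- The fibre over `x` of the cover corresponding to `H`. -/
def Sheet (H : Subgroup (FundamentalGroup M x₀)) (x : M) := Quotient (sheetSetoid H x)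

/-- The cover corresponding to a subgroup `H` of the fundamental group. -/
structure Cover (H : Subgroup (FundamentalGroup M x₀)) where
  /-- the point downstairs -/
  pt : M
  /-- the class of paths to that point -/
  sheet : Sheet H pt

variable {H : Subgroup (FundamentalGroup M x₀)}

/-- Transport of sheets along a homotopy class of paths. -/
def transport {x y : M} (γ : Path.Homotopic.Quotient x y) : Sheet H x → Sheet H y :=
  Quotient.map (fun a => a ≫ (show FundamentalGroupoid.mk x ⟶ FundamentalGroupoid.mk y from γ))
    fun a b h => by
      change _ ∈ H
      have e : ∀ g : FundamentalGroupoid.mk x ⟶ FundamentalGroupoid.mk y,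
        (a ≫ g) ≫ Groupoid.inv (b ≫ g) = a ≫ Groupoid.inv b := fun g => by simp
      rw [e]
      exact h

/-- The sheet of a homotopy class of paths. -/
def sheetMk (H : Subgroup (FundamentalGroup M x₀)) {x : M} (a : Path.Homotopic.Quotient x₀ x) :
    Sheet H x := Quotient.mk (sheetSetoid H x) a

lemma sheetMk_eq_iff {x : M} {a b : FundamentalGroupoid.mk x₀ ⟶ FundamentalGroupoid.mk x} :
    sheetMk H a = sheetMk H b ↔ (a ≫ Groupoid.inv b : FundamentalGroup M x₀) ∈ H :=
  Quotient.eq (r := sheetSetoid H x)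

lemma exists_sheetMk {x : M} (s : Sheet H x) : ∃ a, sheetMk H a = s := Quotient.exists_rep s

lemma transport_sheetMk {x y : M} (γ : Path.Homotopic.Quotient x y)
    (a : Path.Homotopic.Quotient x₀ x) :
    transport γ (sheetMk H a) = sheetMk H (a.trans γ) := rfl

lemma transport_refl {x : M} (s : Sheet H x) :
    transport (Path.Homotopic.Quotient.mk (Path.refl x)) s = s := by
  obtain ⟨a, rfl⟩ := exists_sheetMk s
  rw [transport_sheetMk]
  exact congrArg _ (Path.Homotopic.Quotient.trans_refl a)

lemma transport_trans {x y z : M} (γ : Path.Homotopic.Quotient x y)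
    (δ : Path.Homotopic.Quotient y z) (s : Sheet H x) :
    transport (γ.trans δ) s = transport δ (transport γ s) := by
  obtain ⟨a, rfl⟩ := exists_sheetMk s
  rw [transport_sheetMk, transport_sheetMk, transport_sheetMk,
    Path.Homotopic.Quotient.trans_assoc]

lemma transport_injective {x y : M} (γ : Path.Homotopic.Quotient x y) :
    Function.Injective (transport γ : Sheet H x → Sheet H y) := by
  refine Function.LeftInverse.injective (g := transport γ.symm) fun s => ?_
  rw [← transport_trans, Path.Homotopic.Quotient.trans_symm]
  exact transport_refl s

/-- The end point of the lift of a path. -/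
def Cover.move (e : Cover H) {y : M} (γ : Path e.pt y) : Cover H :=
  ⟨y, transport (Path.Homotopic.Quotient.mk γ) e.sheet⟩

/-- A set is open if it contains the end points of lifts of all sufficiently small paths from its
points. No local assumption on `M` is needed for this to be a topology. -/
instance : TopologicalSpace (Cover H) where
  IsOpen U := ∀ e ∈ U, ∃ N ∈ 𝓝 e.pt, ∀ (y : M) (γ : Path e.pt y), Set.range γ ⊆ N → e.move γ ∈ U
  isOpen_univ := fun _ _ => ⟨Set.univ, Filter.univ_mem, fun _ _ _ => trivial⟩
  isOpen_inter := fun U V hU hV e he => by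
    obtain ⟨N, hN, h⟩ := hU e he.1
    obtain ⟨N', hN', h'⟩ := hV e he.2
    exact ⟨N ∩ N', Filter.inter_mem hN hN', fun y γ hγ =>
      ⟨h y γ (hγ.trans Set.inter_subset_left), h' y γ (hγ.trans Set.inter_subset_right)⟩⟩
  isOpen_sUnion := fun S hS e he => by
    obtain ⟨U, hU, heU⟩ := he
    obtain ⟨N, hN, h⟩ := hS U hU e heU
    exact ⟨N, hN, fun y γ hγ => ⟨U, hU, h y γ hγ⟩⟩

lemma isOpen_iff {U : Set (Cover H)} : IsOpen U ↔ ∀ e ∈ U, ∃ N ∈ 𝓝 e.pt,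
    ∀ (y : M) (γ : Path e.pt y), Set.range γ ⊆ N → e.move γ ∈ U := Iff.rfl

/-- The projection of the cover. -/
def proj (H : Subgroup (FundamentalGroup M x₀)) : C(Cover H, M) where
  toFun := Cover.pt
  continuous_toFun := by
    refine continuous_def.2 fun U hU => isOpen_iff.2 fun e he => ⟨U, hU.mem_nhds he, ?_⟩
    exact fun y γ hγ => hγ ⟨1, γ.target⟩

/-- A flat section of the cover along a map is continuous. -/
lemma continuous_of_flat {Y : Type*} [TopologicalSpace Y] [LocallyPathConnectedSpace Y] (g : C(Y, M))
    (σ : ∀ t, Sheet H (g t)) (hσ : ∀ (t t' : Y) (γ : Path t t'),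
      σ t' = transport (Path.Homotopic.Quotient.mk (γ.map g.continuous)) (σ t)) :
    Continuous fun t => (⟨g t, σ t⟩ : Cover H) := by
  refine continuous_def.2 fun U hU => isOpen_iff_mem_nhds.2 fun t ht => ?_
  obtain ⟨N, hN, h⟩ := isOpen_iff.1 hU _ ht
  -- Within `W`, each `t'` is reached from `t` by a path whose image stays in `N`; by flatness the
  -- section at `t'` is the value moved along it.
  obtain ⟨W, ⟨hW, hWc⟩, hWN⟩ := (path_connected_basis t).mem_iff.1 (g.continuous.continuousAt hN)
  filter_upwards [hW] with t' ht'
  obtain ⟨γ, hγ⟩ := hWc.joinedIn t (mem_of_mem_nhds hW) t' ht'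
  have := h _ (γ.map g.continuous) (by
    rintro _ ⟨s, rfl⟩
    exact hWN (hγ s))
  rw [Set.mem_preimage, hσ t t' γ]
  exact this

/-- A set in which paths with the same end points are homotopic in the ambient space. -/
def RelativelySimple (V : Set M) : Prop :=
  ∀ (x y : M) (γ δ : Path x y), Set.range γ ⊆ V → Set.range δ ⊆ V → γ.Homotopic δ

/-- The sheet through a point over a set. -/
def sheetThrough (V : Set M) (e : Cover H) : Set (Cover H) :=
  {e' | ∃ (y : M) (γ : Path e.pt y), Set.range γ ⊆ V ∧ e' = e.move γ}

lemma range_trans_subset {V : Set M} {x y z : M} {γ : Path x y} {δ : Path y z}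
    (hγ : Set.range γ ⊆ V) (hδ : Set.range δ ⊆ V) : Set.range (γ.trans δ) ⊆ V := by
  rw [Path.trans_range]
  exact Set.union_subset hγ hδ

lemma move_move (e : Cover H) {y z : M} (γ : Path e.pt y) (δ : Path y z) :
    (e.move γ).move δ = e.move (γ.trans δ) := by
  simp only [Cover.move, ← transport_trans]
  rfl

lemma isOpen_sheetThrough {V : Set M} (hV : IsOpen V) (e : Cover H) :
    IsOpen (sheetThrough V e) := by
  rw [isOpen_iff]
  rintro _ ⟨y, γ, hγ, rfl⟩
  refine ⟨V, hV.mem_nhds (hγ ⟨1, γ.target⟩), fun z δ hδ => ⟨z, γ.trans δ,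
    range_trans_subset hγ hδ, move_move e γ δ⟩⟩

lemma mem_sheetThrough {V : Set M} {e : Cover H} (he : e.pt ∈ V) : e ∈ sheetThrough V e := by
  refine ⟨e.pt, Path.refl _, by simpa using he, ?_⟩
  rw [Cover.move, transport_refl]

lemma injOn_sheetThrough {V : Set M} (hV : RelativelySimple V) (e : Cover H) :
    Set.InjOn (proj H) (sheetThrough V e) := by
  rintro _ ⟨y, γ, hγ, rfl⟩ _ ⟨z, δ, hδ, rfl⟩ h
  obtain rfl : y = z := h
  rw [Cover.move, Cover.move, show Path.Homotopic.Quotient.mk γ = Path.Homotopic.Quotient.mk δ from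
    Quotient.sound (hV _ _ γ δ hγ hδ)]

lemma locally_injective (hM : ∀ x : M, ∃ V, IsOpen V ∧ x ∈ V ∧ RelativelySimple V) (e : Cover H) :
    ∃ W ∈ 𝓝 e, Set.InjOn (proj H) W := by
  obtain ⟨V, hV, hx, hs⟩ := hM e.pt
  exact ⟨_, (isOpen_sheetThrough hV e).mem_nhds (mem_sheetThrough hx), injOn_sheetThrough hs e⟩

/-- Points over different points are separated in `M`. Over the same point, a common element of the
two sheets would be reached along homotopic paths, and transport is injective. -/
lemma t2Space [T2Space M] (hM : ∀ x : M, ∃ V, IsOpen V ∧ x ∈ V ∧ RelativelySimple V) :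
    T2Space (Cover H) := by
  refine ⟨fun e e' hne => ?_⟩
  by_cases h : e.pt = e'.pt
  · obtain ⟨V, hV, hx, hs⟩ := hM e.pt
    refine ⟨sheetThrough V e, sheetThrough V e', isOpen_sheetThrough hV e,
      isOpen_sheetThrough hV e', mem_sheetThrough hx, mem_sheetThrough (h ▸ hx), ?_⟩
    rw [Set.disjoint_left]
    rintro _ ⟨y, γ, hγ, rfl⟩ ⟨z, δ, hδ, heq⟩
    obtain ⟨x, s⟩ := e
    obtain ⟨x', s'⟩ := e'
    obtain rfl : x = x' := h
    obtain rfl : y = z := congrArg Cover.pt heq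
    rw [Cover.move, Cover.move, show Path.Homotopic.Quotient.mk γ =
      Path.Homotopic.Quotient.mk δ from Quotient.sound (hs _ _ γ δ hγ hδ)] at heq
    simp only [Cover.mk.injEq, heq_eq_eq, true_and] at heq
    exact hne (by rw [transport_injective _ heq])
  · obtain ⟨U, V, hU, hV, heU, heV, hUV⟩ := t2_separation h
    exact ⟨proj H ⁻¹' U, proj H ⁻¹' V, hU.preimage (proj H).continuous,
      hV.preimage (proj H).continuous, heU, heV, hUV.preimage _⟩

/-- The lift is the flat section over the unit interval obtained by transport from `0`; simple
connectedness of the interval makes it independent of the chosen paths. -/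
lemma joined_move (e : Cover H) {y : M} (γ : Path e.pt y) : Joined e (e.move γ) := by
  obtain ⟨x, s⟩ := e
  obtain ⟨g, h0, h1⟩ := γ
  simp only at h0 h1
  subst h0 h1
  have : ContractibleSpace unitInterval := (convex_Icc (0 : ℝ) 1).contractibleSpace ⟨0, by simp⟩
  have : LocallyPathConnectedSpace unitInterval := (convex_Icc (0 : ℝ) 1).locallyPathConnectedSpace
  let σ : ∀ t, Sheet H (g t) := fun t => transport (Path.Homotopic.Quotient.mk
    ((PathConnectedSpace.somePath (0 : unitInterval) t).map g.continuous)) s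
  have key : ∀ (t t' : unitInterval) (α β : Path t t'),
      Path.Homotopic.Quotient.mk (α.map g.continuous) =
        Path.Homotopic.Quotient.mk (β.map g.continuous) := fun t t' α β =>
    Quotient.sound ((SimplyConnectedSpace.paths_homotopic α β).map g)
  have hσ := continuous_of_flat g σ fun t t' γ => by
    simp only [σ, ← transport_trans]
    congr 1
    rw [← Path.Homotopic.Quotient.mk_trans, ← Path.map_trans]
    exact key _ _ _ _
  refine ⟨⟨⟨_, hσ⟩, ?_, ?_⟩⟩
  · simp only [σ]
    rw [key 0 0 _ (Path.refl 0)]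
    congr 1
    exact transport_refl s
  · simp only [σ]
    rw [key 0 1 _ ⟨ContinuousMap.id _, rfl, rfl⟩]
    rfl

instance preconnectedSpace : PreconnectedSpace (Cover H) := by
  let e₀ : Cover H := ⟨x₀, sheetMk H (Path.Homotopic.Quotient.mk (Path.refl x₀))⟩
  have hj : ∀ e : Cover H, Joined e₀ e := by
    rintro ⟨x, s⟩
    obtain ⟨a, rfl⟩ := exists_sheetMk s
    obtain ⟨γ, rfl⟩ := Quotient.exists_rep a
    have := joined_move e₀ γ
    rw [Cover.move, transport_sheetMk] at this
    erw [Path.Homotopic.Quotient.refl_trans] at this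
    exact this
  have : PathConnectedSpace (Cover H) :=
    ⟨⟨e₀⟩, fun e e' => (hj e).symm.trans (hj e')⟩
  infer_instance

lemma infinite_fibre (hH : ¬ H.FiniteIndex) : (proj H ⁻¹' {x₀}).Infinite := by
  intro hfin
  apply hH
  have : Finite (proj H ⁻¹' {x₀}) := hfin
  have : Finite (FundamentalGroup M x₀ ⧸ H) := by
    refine Finite.of_injective (β := proj H ⁻¹' {x₀})
      (fun q => ⟨⟨x₀, sheetMk H q.out⟩, rfl⟩) fun q q' h => ?_
    have h : sheetMk H q.out = sheetMk H q'.out :=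
      eq_of_heq (Cover.mk.inj (congrArg Subtype.val h)).2
    -- Multiplication in the fundamental group is composition in reverse order, so the relation
    -- defining sheets is the one defining left cosets.
    have h' : q'.out⁻¹ * q.out ∈ H := sheetMk_eq_iff.1 h
    rw [← QuotientGroup.out_eq' q, ← QuotientGroup.out_eq' q']
    exact (QuotientGroup.eq.2 h').symm
  exact Subgroup.finiteIndex_of_finite_quotient

lemma mapOfEq_rfl {N : Type*} [TopologicalSpace N] (f : C(N, M)) (y : N)
    (a : FundamentalGroup N y) :
    FundamentalGroup.mapOfEq f (rfl : f y = f y) a = (FundamentalGroupoid.map f).map a := by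
  rw [FundamentalGroup.mapOfEq_apply]
  simp

/-- A map lifts to the cover corresponding to the image of its fundamental group. -/
lemma exists_lift {N : Type*} [TopologicalSpace N] [LocallyPathConnectedSpace N]
    [PathConnectedSpace N] (f : C(N, M)) (y₀ : N) :
    ∃ g : C(N, Cover (FundamentalGroup.mapOfEq f (rfl : f y₀ = f y₀)).range),
      (proj _).comp g = f := by
  set H := (FundamentalGroup.mapOfEq f (rfl : f y₀ = f y₀)).range
  let σ : ∀ y, Sheet H (f y) := fun y => sheetMk H (Path.Homotopic.Quotient.mk
    ((PathConnectedSpace.somePath y₀ y).map f.continuous))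
  refine ⟨⟨fun y => ⟨f y, σ y⟩, continuous_of_flat f σ fun t t' γ => ?_⟩, rfl⟩
  simp only [σ]
  rw [transport_sheetMk]
  refine sheetMk_eq_iff.2 ?_
  let F := FundamentalGroupoid.map f
  let α : FundamentalGroupoid.mk y₀ ⟶ FundamentalGroupoid.mk t :=
    Path.Homotopic.Quotient.mk (PathConnectedSpace.somePath y₀ t)
  let β : FundamentalGroupoid.mk y₀ ⟶ FundamentalGroupoid.mk t' :=
    Path.Homotopic.Quotient.mk (PathConnectedSpace.somePath y₀ t')
  let δ : FundamentalGroupoid.mk t ⟶ FundamentalGroupoid.mk t' := Path.Homotopic.Quotient.mk γ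
  -- The loop in `N` out along the path chosen for `t'`, and back along `γ` and the path chosen for
  -- `t`; its image measures the failure of flatness and lies in `H` by definition.
  refine ⟨(β ≫ Groupoid.inv (α ≫ δ) : FundamentalGroup N y₀), ?_⟩
  rw [mapOfEq_rfl]
  change F.map (β ≫ Groupoid.inv (α ≫ δ)) = F.map β ≫ Groupoid.inv (F.map α ≫ F.map δ)
  simp [Groupoid.inv_eq_inv]

end SubgroupCover

end

/-! ### Local simplicity of manifolds -/

noncomputable section

namespace SubgroupCover

variable {M : Type u} [TopologicalSpace M]

lemma relativelySimple_of_simplyConnected {V : Set M} [SimplyConnectedSpace V] :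
    RelativelySimple V := by
  intro x y γ δ hγ hδ
  have hx : x ∈ V := hγ ⟨0, γ.source⟩
  have hy : y ∈ V := hγ ⟨1, γ.target⟩
  let γ' : Path (⟨x, hx⟩ : V) ⟨y, hy⟩ :=
    ⟨⟨fun t => ⟨γ t, hγ ⟨t, rfl⟩⟩, γ.continuous.subtype_mk _⟩, by simp, by simp⟩
  let δ' : Path (⟨x, hx⟩ : V) ⟨y, hy⟩ :=
    ⟨⟨fun t => ⟨δ t, hδ ⟨t, rfl⟩⟩, δ.continuous.subtype_mk _⟩, by simp, by simp⟩
  exact (SimplyConnectedSpace.paths_homotopic γ' δ').map ⟨Subtype.val, continuous_subtype_val⟩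

/-- A coordinate ball is contractible, so paths in it with common end points are homotopic. -/
lemma exists_relativelySimple {n : ℕ} [ChartedSpace (EuclideanSpace ℝ (Fin n)) M] (x : M) :
    ∃ V : Set M, IsOpen V ∧ x ∈ V ∧ RelativelySimple V := by
  let φ := chartAt (EuclideanSpace ℝ (Fin n)) x
  obtain ⟨r, hr, hball⟩ := Metric.isOpen_iff.1 φ.open_target (φ x) (mem_chart_target _ x)
  let e := φ.symm.restrOpen (Metric.ball (φ x) r) Metric.isOpen_ball
  have hsrc : e.source = Metric.ball (φ x) r := by
    simpa [e] using hball
  refine ⟨e.target, e.open_target, ?_, ?_⟩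
  · have : φ x ∈ e.source := by rw [hsrc]; exact Metric.mem_ball_self hr
    have h2 := e.map_source this
    have h3 : e (φ x) = x := φ.left_inv (mem_chart_source _ x)
    rwa [h3] at h2
  · have : ContractibleSpace e.source := by
      rw [hsrc]
      exact (convex_ball (φ x) r).contractibleSpace ⟨φ x, Metric.mem_ball_self hr⟩
    have : ContractibleSpace e.target := e.toHomeomorphSourceTarget.symm.contractibleSpace
    exact relativelySimple_of_simplyConnected

end SubgroupCover

/-! ### Images of fundamental groups under a `Γ`-structure -/

namespace GammaManifold

variable {M : Type u} [TopologicalSpace M]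

/-- A map of non-zero degree has image of finite index on fundamental groups. -/
theorem HasMappingDegree.finiteIndex_range {n : ℕ} [T2Space M] [ConnectedSpace M]
    [ChartedSpace (EuclideanSpace ℝ (Fin (n + 1))) M] {o : Orientation (n + 1) M} {f : C(M, M)}
    {k : ℤ} (hf : HasMappingDegree o f k) (hk : k ≠ 0) (y : M) :
    (FundamentalGroup.mapOfEq f (rfl : f y = f y)).range.FiniteIndex := by
  by_contra hH
  have : LocallyPathConnectedSpace M :=
    ChartedSpace.locallyPathConnectedSpace (EuclideanSpace ℝ (Fin (n + 1))) M
  have : PathConnectedSpace M := pathConnectedSpace_iff_connectedSpace.2 inferInstance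
  have hM := SubgroupCover.exists_relativelySimple (M := M) (n := n + 1)
  obtain ⟨g, hg⟩ := SubgroupCover.exists_lift f y
  have := SubgroupCover.t2Space (H := (FundamentalGroup.mapOfEq f (rfl : f y = f y)).range) hM
  exact hk (SingularChain.degree_eq_zero_of_lift o hf (SubgroupCover.locally_injective hM) hg
    (SubgroupCover.infinite_fibre hH))

/-- A path in the parameter space gives a homotopy of restrictions. -/
def restrictLeftHomotopy (ψ : C(M × M, M)) {p p' : M} (γ : Path p p') :
    (restrictLeft ψ p).Homotopy (restrictLeft ψ p') where
  toFun t := ψ (γ t.1, t.2)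
  continuous_toFun := by fun_prop
  map_zero_left y := by simp [restrictLeft]
  map_one_left y := by simp [restrictLeft]

/-- A path in the parameter space gives a homotopy of restrictions. -/
def restrictRightHomotopy (ψ : C(M × M, M)) {q q' : M} (γ : Path q q') :
    (restrictRight ψ q).Homotopy (restrictRight ψ q') where
  toFun t := ψ (t.2, γ t.1)
  continuous_toFun := by fun_prop
  map_zero_left y := by simp [restrictRight]
  map_one_left y := by simp [restrictRight]

/-- Paths from the given parameters to `p` and `q` give homotopies of the restrictions, so non-zero
degree at one parameter is non-zero degree at all. -/
lemma IsGammaStructure.finiteIndex {n : ℕ} [T2Space M] [ConnectedSpace M]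
    [ChartedSpace (EuclideanSpace ℝ (Fin (n + 1))) M] {o : Orientation (n + 1) M}
    {ψ : C(M × M, M)} (hψ : IsGammaStructure o ψ) (p q : M) :
    (leftImage ψ p q).FiniteIndex ∧ (rightImage ψ p q).FiniteIndex := by
  have : LocallyPathConnectedSpace M :=
    ChartedSpace.locallyPathConnectedSpace (EuclideanSpace ℝ (Fin (n + 1))) M
  have : PathConnectedSpace M := pathConnectedSpace_iff_connectedSpace.2 inferInstance
  obtain ⟨p₀, q₀, ⟨k, hk, hl⟩, ⟨m, hm, hr⟩⟩ := hψ
  exact ⟨(hl.of_homotopic (restrictLeftHomotopy ψ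
      (PathConnectedSpace.somePath p₀ p))).finiteIndex_range hk q,
    (hr.of_homotopic (restrictRightHomotopy ψ
      (PathConnectedSpace.somePath q₀ q))).finiteIndex_range hm p⟩

/-- Both classes are images under `ψ` of loops at `(p, q)` that are constant in one factor, and such
loops commute because composition in a product is componentwise. -/
lemma mul_comm_of_mem_images (ψ : C(M × M, M)) (p q : M) :
    ∀ a ∈ leftImage ψ p q, ∀ b ∈ rightImage ψ p q, a * b = b * a := by
  rintro _ ⟨α, rfl⟩ _ ⟨β, rfl⟩
  obtain ⟨γ, rfl⟩ := Quotient.exists_rep α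
  obtain ⟨δ, rfl⟩ := Quotient.exists_rep β
  let F := FundamentalGroupoid.map ψ
  let A : FundamentalGroupoid.mk (p, q) ⟶ FundamentalGroupoid.mk (p, q) :=
    Path.Homotopic.prod (Path.Homotopic.Quotient.refl p) (Path.Homotopic.Quotient.mk γ)
  let B : FundamentalGroupoid.mk (p, q) ⟶ FundamentalGroupoid.mk (p, q) :=
    Path.Homotopic.prod (Path.Homotopic.Quotient.mk δ) (Path.Homotopic.Quotient.refl q)
  have hA : FundamentalGroup.mapOfEq (restrictLeft ψ p) (x := q) (y := ψ (p, q)) rfl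
      (Path.Homotopic.Quotient.mk γ) = F.map A := by
    exact (SubgroupCover.mapOfEq_rfl (restrictLeft ψ p) q _).trans rfl
  have hB : FundamentalGroup.mapOfEq (restrictRight ψ q) (x := p) (y := ψ (p, q)) rfl
      (Path.Homotopic.Quotient.mk δ) = F.map B := by
    exact (SubgroupCover.mapOfEq_rfl (restrictRight ψ q) p _).trans rfl
  have hAB : B ≫ A = A ≫ B := by
    change Path.Homotopic.Quotient.trans (Path.Homotopic.prod _ _) (Path.Homotopic.prod _ _) =
      Path.Homotopic.Quotient.trans (Path.Homotopic.prod _ _) (Path.Homotopic.prod _ _)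
    rw [Path.Homotopic.comp_prod_eq_prod_comp, Path.Homotopic.comp_prod_eq_prod_comp]
    simp
  refine (congrArg₂ (· * ·) hA hB).trans (Eq.trans ?_ (congrArg₂ (· * ·) hB hA).symm)
  change F.map B ≫ F.map A = F.map A ≫ F.map B
  rw [← F.map_comp, ← F.map_comp, hAB]

lemma isMulCommutative_inf (ψ : C(M × M, M)) (p q : M) :
    IsMulCommutative (leftImage ψ p q ⊓ rightImage ψ p q :
      Subgroup (FundamentalGroup M (ψ (p, q)))) := by
  rw [isMulCommutative_iff]
  rintro ⟨a, ha⟩ ⟨b, hb⟩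
  exact Subtype.ext (mul_comm_of_mem_images ψ p q a ha.1 b hb.2)

lemma IsVirtuallyAbelian.of_mulEquiv {G G' : Type*} [Group G] [Group G'] (e : G ≃* G')
    (h : IsVirtuallyAbelian G) : IsVirtuallyAbelian G' := by
  obtain ⟨N, hN, hfin⟩ := h
  refine ⟨N.map e.toMonoidHom, inferInstance, ⟨?_⟩⟩
  exact (Subgroup.index_map_equiv N e).trans_ne hfin.index_ne_zero

/-- Chart domains are single points, so the space is discrete, and it is connected. -/
lemma subsingleton_of_chartedSpace_zero [ConnectedSpace M]
    [ChartedSpace (EuclideanSpace ℝ (Fin 0)) M] : Subsingleton M := by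
  have : DiscreteTopology M := by
    refine discreteTopology_iff_isOpen_singleton.2 fun x => ?_
    have hs : (chartAt (EuclideanSpace ℝ (Fin 0)) x).source = {x} := by
      refine Set.eq_singleton_iff_unique_mem.2 ⟨mem_chart_source _ x, fun y hy => ?_⟩
      exact (chartAt (EuclideanSpace ℝ (Fin 0)) x).injOn hy (mem_chart_source _ x)
        (Subsingleton.elim _ _)
    rw [← hs]
    exact (chartAt _ x).open_source
  exact PreconnectedSpace.trivial_of_discrete

instance [Subsingleton M] (x : M) : Subsingleton (FundamentalGroup M x) := by
  refine ⟨fun a b => ?_⟩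
  obtain ⟨γ, rfl⟩ := Quotient.exists_rep a
  obtain ⟨δ, rfl⟩ := Quotient.exists_rep b
  congr 1
  ext t
  exact Subsingleton.elim _ _

end GammaManifold

end

theorem mainTheorem9 {n : ℕ} {M : Type u} [TopologicalSpace M] [T2Space M] [CompactSpace M]
    [ConnectedSpace M] [ChartedSpace (EuclideanSpace ℝ (Fin n)) M]
    (o : GammaManifold.Orientation n M) (ψ : C(M × M, M))
    (hψ : GammaManifold.IsGammaStructure o ψ) :
    (∀ x : M, GammaManifold.IsVirtuallyAbelian (FundamentalGroup M x)) ∧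
    ∀ p q : M,
      (GammaManifold.leftImage ψ p q).FiniteIndex ∧
      (GammaManifold.rightImage ψ p q).FiniteIndex ∧
      (∀ a ∈ GammaManifold.leftImage ψ p q, ∀ b ∈ GammaManifold.rightImage ψ p q,
        a * b = b * a) ∧
      (GammaManifold.leftImage ψ p q ⊓ GammaManifold.rightImage ψ p q).FiniteIndex ∧
      IsMulCommutative
        (GammaManifold.leftImage ψ p q ⊓ GammaManifold.rightImage ψ p q :
          Subgroup (FundamentalGroup M (ψ (p, q)))) := by
  have key : ∀ p q : M, (GammaManifold.leftImage ψ p q).FiniteIndex ∧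
      (GammaManifold.rightImage ψ p q).FiniteIndex := by
    cases n with
    -- The degree argument works with cycles in positive degree; in dimension zero `M` is a point
    -- and its fundamental group is trivial.
    | zero =>
      have : Subsingleton M := GammaManifold.subsingleton_of_chartedSpace_zero
      exact fun p q => ⟨inferInstance, inferInstance⟩
    | succ n => exact hψ.finiteIndex
  have hinf : ∀ p q : M,
      (GammaManifold.leftImage ψ p q ⊓ GammaManifold.rightImage ψ p q).FiniteIndex := fun p q => by
    have := (key p q).1
    have := (key p q).2
    infer_instance
  have : LocallyPathConnectedSpace M :=
    ChartedSpace.locallyPathConnectedSpace (EuclideanSpace ℝ (Fin n)) M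
  have : PathConnectedSpace M := pathConnectedSpace_iff_connectedSpace.2 inferInstance
  refine ⟨fun x => ?_, fun p q => ⟨(key p q).1, (key p q).2,
    GammaManifold.mul_comm_of_mem_images ψ p q, hinf p q,
    GammaManifold.isMulCommutative_inf ψ p q⟩⟩
  -- The subgroup lives at the base point `ψ (x, x)`; a change of base point moves it to `x`.
  exact GammaManifold.IsVirtuallyAbelian.of_mulEquiv
    (FundamentalGroup.fundamentalGroupMulEquivOfPathConnected (ψ (x, x)) x)
    ⟨_, GammaManifold.isMulCommutative_inf ψ x x, hinf x x⟩
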